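/- Setting. Inputs are $\mathbf x=(\mathbf x^1,\dots,\mathbf x^n)\in\mathcal X=(\mathbb S^{d-1})^n$. For $\sigma:\mathbb R\to\mathbb R$ let $\|\sigma\|=\big(\mathbb E_{X\sim N(0,1)}\sigma(X)^2\big)^{1/2}$; an activation is a $\sigma$ that is square integrable for the standard Gaussian measure. It is $C$-bounded if it is twice continuously differentiable and $\|\sigma\|_\infty,\|\sigma'\|_\infty,\|\sigma''\|_\infty\le C\|\sigma\|$. The dual activation is $\hat\sigma(\rho)=\mathbb E\,\sigma(X)\sigma(Y)$ for $\rho\in[-1,1]$, where $(X,Y)$ is centred Gaussian with covariance matrix $\begin{pmatrix}1&\rho\\ \rho&1\end{pmatrix}$. A computation skeleton $\mathcal S$ is a finite directed acyclic graph with $n$ input nodes (those without incoming edges), the $i$-th corresponding to the coordinate $\mathbf x^i$, whose non-input nodes $v$ are labelled by activations $\sigma_v$, and which has a single output node $o$ (the only non-input node without outgoing edges). $\mathrm{IN}(v)$ is the set of nodes with an edge into $v$, $|\mathcal S|$ is the number of non-input nodes, and $\mathrm{depth}(\mathcal S)$ is the number of edges of a longest directed path. The compositional kernel is $\kappa_{\mathcal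 S}=\kappa_o$, where $\kappa_v(\mathbf x,\mathbf y)=\langle\mathbf x^i,\mathbf y^i\rangle$ at the $i$-th input node and, at a non-input node, $$\kappa_v(\mathbf x,\mathbf y)=\widehat{\bar\sigma_v}\Big(\frac1{|\mathrm{IN}(v)|}\sum_{u\in \mathrm{IN}(v)}\kappa_u(\mathbf x,\mathbf y)\Big),\qquad \bar\sigma_v=\sigma_v/\|\sigma_v\| .$$ The $r$-fold realization $\mathcal N(\mathcal S,r)$ is the network in which each input node becomes $d$ input neurons of vertex weight $1/d$, each non-input node $v$ becomes $r$ neurons $v^1,\dots,v^r$ of vertex weight $1/r$ with activation $\sigma_v$, and each edge $uv$ of $\mathcal S$ becomes edges from all copies of $u$ to all copies of $v$; its output neurons are $o^1,\dots,o^r$. Given edge weights $\mathbf w$, the input neurons output the entries of $\mathbf x$, and every other neuron $v$ outputs $h_{v,\mathbf w}(\mathbf x)=\sigma_v\big(\sum_{u\in\mathrm{IN}(v)}w_{uv}h_{u,\mathbf w}(\mathbf x)\big)$. In a random initialization the $w_{uv}$ are independent centred Gaussians, with variance $d\,\delta(u)/\delta(\mathrm{IN}(v))$ if $u$ is an input neuron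 and $\delta(u)/(\|\sigma_u\|^2\,\delta(\mathrm{IN}(v)))$ otherwise, where $\delta(u)$ is the vertex weight of $u$ and $\delta(U)=\sum_{u\in U}\delta(u)$. The empirical kernel is $\kappa_{\mathbf w}(\mathbf x,\mathbf x')=\langle\Psi_{\mathbf w}(\mathbf x),\Psi_{\mathbf w}(\mathbf x')\rangle$, where $\Psi_{\mathbf w}(\mathbf x)=\big(h_{o^j,\mathbf w}(\mathbf x)/(\|\sigma_o\|\sqrt r)\big)_{j=1}^r$. Theorem. Let $\mathcal S$ be a computation skeleton whose activations are $C$-bounded and not identically zero, let $\epsilon,\delta>0$, and let $\mathbf w$ be a random initialization of $\mathcal N(\mathcal S,r)$ with $$r\ \ge\ \frac{(4C^4)^{\mathrm{depth}(\mathcal S)+1}\,\log(8|\mathcal S|/\delta)}{\epsilon^2}.$$ Then, for all $\mathbf x,\mathbf x'\in\mathcal X$, with probability at least $1-\delta$ over $\mathbf w$, $$|\kappa_{\mathbf w}(\mathbf x,\mathbf x')-\kappa_{\mathcal S}(\mathbf x,\mathbf x')|\le\epsilon .$$ -/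

import Mathlib

open MeasureTheory ProbabilityTheory
open scoped NNReal

noncomputable section

/-! ### Activations -/

/-- The Gaussian norm `‖σ‖ = (𝔼_{X ∼ N(0,1)} σ(X)²)^{1/2}` of `σ : ℝ → ℝ`. -/
def gaussNorm (σ : ℝ → ℝ) : ℝ :=
  Real.sqrt (∫ x, σ x ^ 2 ∂(gaussianReal 0 1))

/-- An activation is a function that is square integrable for the standard Gaussian measure. -/
def IsActivation (σ : ℝ → ℝ) : Prop :=
  MemLp σ 2 (gaussianReal 0 1)

/-- `σ` is `C`-bounded: it is `C²` and `‖σ‖_∞, ‖σ'‖_∞, ‖σ''‖_∞ ≤ ‖σ‖ C`. -/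
def IsCBounded (C : ℝ) (σ : ℝ → ℝ) : Prop :=
  ContDiff ℝ 2 σ ∧
    (∀ x, |σ x| ≤ gaussNorm σ * C) ∧
    (∀ x, |deriv σ x| ≤ gaussNorm σ * C) ∧
    (∀ x, |deriv (deriv σ) x| ≤ gaussNorm σ * C)

/-- The normalization `σ / ‖σ‖`. -/
def normalizeAct (σ : ℝ → ℝ) : ℝ → ℝ := fun x => σ x / gaussNorm σ

/-- The dual activation `σ̂(ρ) = 𝔼 σ(X) σ(Y)`, where `(X, Y)` is a centred Gaussian vector with
covariance matrix `(1 ρ; ρ 1)`. It is only meaningful (and only used) for `ρ ∈ [-1, 1]`. -/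
def dualAct (σ : ℝ → ℝ) (ρ : ℝ) : ℝ :=
  ∫ z : EuclideanSpace ℝ (Fin 2), σ (z 0) * σ (z 1) ∂(multivariateGaussian 0 !![1, ρ; ρ, 1])

/-! ### Directed acyclic graphs with distinguished input nodes -/

/-- A directed acyclic graph on the nodes `I ⊕ V`. The nodes in `I` are the input nodes, and have
no incoming edges; `Adj u v` says that there is an edge from `u` to the non-input node `v`. -/
structure Dag (I V : Type*) where
  Adj : I ⊕ V → V → Prop
  acyclic : ∀ v : V, ¬ Relation.TransGen (fun u v : V => Adj (Sum.inr u) v) v v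

namespace Dag

variable {I V : Type*} (G : Dag I V)

theorem wellFounded [Finite V] : WellFounded (fun u v : V => G.Adj (Sum.inr u) v) := by
  have : IsTrans V (Relation.TransGen (fun u v : V => G.Adj (Sum.inr u) v)) :=
    ⟨fun _ _ _ => Relation.TransGen.trans⟩
  have : Std.Irrefl (Relation.TransGen (fun u v : V => G.Adj (Sum.inr u) v)) := ⟨G.acyclic⟩
  have h := Finite.wellFounded_of_trans_of_irrefl
    (Relation.TransGen (fun u v : V => G.Adj (Sum.inr u) v))
  exact Subrelation.wf (fun h => Relation.TransGen.single h) h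

/-- `IN(v)`, the set of nodes with an edge into `v`. -/
def inNbrs [Fintype I] [Fintype V] (v : V) : Finset (I ⊕ V) := by
  classical exact Finset.univ.filter (fun u => G.Adj u v)

/-- The edges of the graph, as a type. -/
def Edge : Type _ := {e : (I ⊕ V) × V // G.Adj e.1 e.2}

instance [Fintype I] [Fintype V] : Fintype G.Edge := by
  classical exact inferInstanceAs (Fintype {e : (I ⊕ V) × V // G.Adj e.1 e.2})

instance [Fintype I] [Fintype V] (v : V) : Fintype {u : I ⊕ V // G.Adj u v} := by
  classical exact inferInstance

/-- Propagation through the graph: the input nodes have the values `a`, and the value of a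
non-input node `v` is `f v` applied to the values of the nodes in `IN(v)`. -/
def propagate [Finite V] {α : Type*} (f : ∀ v : V, ({u : I ⊕ V // G.Adj u v} → α) → α)
    (a : I → α) : I ⊕ V → α :=
  Sum.elim a <| G.wellFounded.fix fun v ih =>
    f v fun u => match u with
      | ⟨Sum.inl i, _⟩ => a i
      | ⟨Sum.inr u, h⟩ => ih u h

theorem propagate_inl [Finite V] {α : Type*} (f : ∀ v : V, ({u : I ⊕ V // G.Adj u v} → α) → α)
    (a : I → α) (i : I) : G.propagate f a (Sum.inl i) = a i := rfl

theorem propagate_inr [Finite V] {α : Type*} (f : ∀ v : V, ({u : I ⊕ V // G.Adj u v} → α) → α)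
    (a : I → α) (v : V) :
    G.propagate f a (Sum.inr v) = f v (fun u => G.propagate f a u.1) := by
  conv_lhs => rw [propagate, Sum.elim_inr, WellFounded.fix_eq]
  congr 1
  funext u
  rcases u with ⟨u | u, h⟩ <;> rfl

/-- The depth of a node: `0` for an input node, one more than the maximal depth of a node in
`IN(v)` for a non-input node `v`. This is the length of the longest directed path ending there. -/
def nodeDepth [Fintype I] [Fintype V] : I ⊕ V → ℕ :=
  G.propagate (fun _ g => Finset.univ.sup g + 1) (fun _ => 0)

/-- The depth of the graph: the length of its longest directed path. -/
def depth [Fintype I] [Fintype V] : ℕ := Finset.univ.sup G.nodeDepth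

end Dag

/-! ### Inputs, neural networks and random weights -/

/-- The input space: sequences of `n` unit vectors of `ℝ^d`. -/
abbrev InputSpace (n d : ℕ) : Type :=
  Fin n → Metric.sphere (0 : EuclideanSpace ℝ (Fin d)) 1

/-- A neural network with `n * d` input neurons and set of non-input neurons `V`. The vertex weight
`vwt` only serves to prescribe the distribution of the random initial edge weights. -/
structure NeuralNetwork (n d : ℕ) (V : Type*) extends Dag (Fin n × Fin d) V where
  act : V → ℝ → ℝ
  isActivation : ∀ v, IsActivation (act v)
  vwt : (Fin n × Fin d) ⊕ V → ℝ≥0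

namespace NeuralNetwork

variable {n d : ℕ} {V : Type*} [Fintype V] (N : NeuralNetwork n d V)

/-- The output `h_{v,w}(x)` of every neuron `v`, for the edge weights `w`:
`h_v(x) = σ_v (∑_{u ∈ IN(v)} w_{uv} h_u(x))`, and input neurons output the entries of `x`. -/
def eval (w : N.Edge → ℝ) (x : InputSpace n d) : (Fin n × Fin d) ⊕ V → ℝ :=
  N.propagate (fun v h => N.act v (∑ u, w ⟨(u.1, v), u.2⟩ * h u))
    (fun p => (x p.1 : EuclideanSpace ℝ (Fin d)) p.2)

/-- The total vertex weight of `IN(v)`. -/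
def inWt (v : V) : ℝ := ∑ u ∈ N.inNbrs v, (N.vwt u : ℝ)

/-- The variance of the random initial weight of an edge `uv`: `d δ(u) / δ(IN(v))` if `u` is an
input neuron, and `δ(u) / (‖σ_u‖² δ(IN(v)))` otherwise, where `δ` is the vertex weight. -/
def edgeVar (e : N.Edge) : ℝ :=
  match e.1.1 with
  | Sum.inl p => (d : ℝ) * N.vwt (Sum.inl p) / N.inWt e.1.2
  | Sum.inr u => N.vwt (Sum.inr u) / (gaussNorm (N.act u) ^ 2 * N.inWt e.1.2)

/-- The law of a random initialization: independent centred Gaussian edge weights with the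
variances `edgeVar`. -/
def randomInit : Measure (N.Edge → ℝ) :=
  Measure.pi fun e => gaussianReal 0 (N.edgeVar e).toNNReal

/-- The output neurons: the non-input neurons without outgoing edges. -/
def outputs : Finset V := by
  classical exact Finset.univ.filter (fun v => ∀ u, ¬ N.Adj (Sum.inr v) u)

/-- The normalized representation `Ψ_w(x)`: the output of each of the `q` output neurons `v` is
divided by `‖σ_v‖ √q`. (Here `N` is itself the representation part of a network.) -/
def normRep (w : N.Edge → ℝ) (x : InputSpace n d) : EuclideanSpace ℝ N.outputs :=
  WithLp.toLp 2 fun v =>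
    N.eval w x (Sum.inr v.1) / (gaussNorm (N.act v.1) * Real.sqrt (N.outputs.card : ℝ))

/-- The empirical kernel `κ_w(x, x') = ⟨Ψ_w(x), Ψ_w(x')⟩`. -/
def empKernel (w : N.Edge → ℝ) (x x' : InputSpace n d) : ℝ :=
  inner ℝ (N.normRep w x) (N.normRep w x')

end NeuralNetwork

/-! ### Computation skeletons -/

/-- A computation skeleton with `n` input nodes (one for each input coordinate), set of non-input
nodes `V` and a single output node `out`: a DAG whose non-input nodes are labelled by activations.
The nodes in `V` are those with an incoming edge, and `out` is the only one of them without
outgoing edges. -/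
structure Skeleton (n : ℕ) (V : Type*) extends Dag (Fin n) V where
  exists_adj : ∀ v, ∃ u, Adj u v
  act : V → ℝ → ℝ
  isActivation : ∀ v, IsActivation (act v)
  out : V
  out_iff : ∀ v, (∀ u, ¬ Adj (Sum.inr v) u) ↔ v = out

namespace Skeleton

variable {n : ℕ} {V : Type*} (S : Skeleton n V)

/-- The compositional kernels of all nodes: `κ_v(x, y) = ⟨x^i, y^i⟩` at the `i`-th input node, and
`κ_v(x, y) = σ̂_v ((∑_{u ∈ IN(v)} κ_u(x, y)) / |IN(v)|)` at the other nodes, where the activations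
are normalized first. -/
def nodeKernel [Fintype V] {d : ℕ} (x y : InputSpace n d) : Fin n ⊕ V → ℝ :=
  S.propagate
    (fun v κ => dualAct (normalizeAct (S.act v)) ((∑ u, κ u) / ((S.inNbrs v).card : ℝ)))
    (fun i => inner ℝ (x i : EuclideanSpace ℝ (Fin d)) (y i : EuclideanSpace ℝ (Fin d)))

/-- The compositional kernel `κ_S` of the skeleton. -/
def kernel [Fintype V] {d : ℕ} (x y : InputSpace n d) : ℝ :=
  S.nodeKernel x y (Sum.inr S.out)

/-- The edges of the `r`-fold realization: a copy of `v` receives an edge from every copy of every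
`u ∈ IN(v)`, where an input node has `d` copies and any other node has `r` copies. -/
def realizationAdj (d r : ℕ) : (Fin n × Fin d) ⊕ (V × Fin r) → V × Fin r → Prop :=
  fun u v => S.Adj (Sum.map Prod.fst Prod.fst u) v.1

/-- The `r`-fold realization `N(S, r)` for inputs with coordinates in `ℝ^d`: each input node becomes
`d` input neurons of vertex weight `1/d`, each other node becomes `r` neurons of vertex weight `1/r`
with the same activation. Its output neurons are the `r` copies of the output node. -/
def realization (d r : ℕ) : NeuralNetwork n d (V × Fin r) where
  Adj := S.realizationAdj d r
  acyclic v h := S.acyclic v.1 (h.lift Prod.fst fun _ _ hab => hab)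
  act v := S.act v.1
  isActivation v := S.isActivation v.1
  vwt := Sum.elim (fun _ => 1 / (d : ℝ≥0)) (fun _ => 1 / (r : ℝ≥0))

end Skeleton

end

/-! Attach to every skeleton node `v` the empirical kernel `empNode`, the average over its `r`
copies of products of normalized outputs. Freeze all weights except those entering the copies of
`v`. By acyclicity the neurons feeding `v` are then fixed, so the copies receive independent
Gaussian input pairs with one common covariance, whose entries are the means over `IN(v)` of the
empirical kernels (`sum_edgeVar_mul`). Hence `empNode` at `v` is a mean of `r` i.i.d. variables
bounded by `C ^ 2`, with expectation `pairDual` at that random covariance. Hoeffding's inequality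
and Fubini bound the deviation, `layerError`, at each single node (`measureReal_layerError_le`).

To pass from the random covariance to the ideal one, `abs_pairDual_sub_le` shows that `pairDual` is
`2 * C ^ 2`-Lipschitz for the largest change of a covariance entry. The proof interpolates between
two independent Gaussian pairs and integrates by parts, so singular covariances need no separate
treatment. If all single-node errors are at most `η`, the error `e k` at depth `k` satisfies `e
(k+1) ≤ η + 2 * C ^ 2 * e k`, giving `((2 * C ^ 2) ^ k - 1) * η` (`abs_empNode_sub_nodeKernel_le`).
The random variances also deviate from 1, so the diagonal pairs must be controlled along with `(x,
x')`.

Taking `η = ε / (2 * C ^ 2) ^ depth` and a union bound over nodes and the four ordered pairs from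
`{x, x'}` finishes the proof. -/

noncomputable section

/-! ### Gaussian pairs as linear images of independent Gaussians -/

/-- The expectation `𝔼 σ(X) σ(Y)` for a centred Gaussian vector `(X, Y)` with
`𝔼 X² = a`, `𝔼 Y² = b` and `𝔼 XY = c`. -/
def pairDual (σ : ℝ → ℝ) (a b c : ℝ) : ℝ :=
  ∫ z : EuclideanSpace ℝ (Fin 2), σ (z 0) * σ (z 1) ∂(multivariateGaussian 0 !![a, c; c, b])

theorem dualAct_eq_pairDual (σ : ℝ → ℝ) (ρ : ℝ) : dualAct σ ρ = pairDual σ 1 1 ρ := rfl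

theorem posSemidef_gram_two {ι : Type*} [Fintype ι] (v : ι → ℝ≥0) (p q : ι → ℝ) :
    (!![∑ i, v i * p i ^ 2, ∑ i, v i * (p i * q i);
      ∑ i, v i * (p i * q i), ∑ i, v i * q i ^ 2] : Matrix (Fin 2) (Fin 2) ℝ).PosSemidef := by
  refine Matrix.PosSemidef.of_dotProduct_mulVec_nonneg ?_ fun x => ?_
  · ext i j
    fin_cases i <;> fin_cases j <;> simp
  · have : star x ⬝ᵥ (!![∑ i, v i * p i ^ 2, ∑ i, v i * (p i * q i);
      ∑ i, v i * (p i * q i), ∑ i, v i * q i ^ 2] : Matrix (Fin 2) (Fin 2) ℝ).mulVec x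
        = ∑ i, v i * (x 0 * p i + x 1 * q i) ^ 2 := by
      simp [Matrix.mulVec, dotProduct, Fin.sum_univ_two, Finset.mul_sum, Finset.sum_mul,
        ← Finset.sum_add_distrib]
      refine Finset.sum_congr rfl fun i _ => ?_
      ring
    rw [this]
    positivity

/-- Characteristic functions agree: at `t`, that of the pair is that of the product measure at the
vector `t 0 * p + t 1 * q`. No density is used, so the covariance may be singular. -/
theorem map_pi_gaussianReal_pair {ι : Type*} [Fintype ι] (v : ι → ℝ≥0) (p q : ι → ℝ) :
    (Measure.pi fun i => gaussianReal 0 (v i)).map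
        (fun w => (!₂[∑ i, p i * w i, ∑ i, q i * w i] : EuclideanSpace ℝ (Fin 2)))
      = multivariateGaussian 0 !![∑ i, v i * p i ^ 2, ∑ i, v i * (p i * q i);
          ∑ i, v i * (p i * q i), ∑ i, v i * q i ^ 2] := by
  have hmeas : Measurable (fun w : ι → ℝ =>
      (!₂[∑ i, p i * w i, ∑ i, q i * w i] : EuclideanSpace ℝ (Fin 2))) := by
    fun_prop
  have : IsProbabilityMeasure ((Measure.pi fun i => gaussianReal 0 (v i)).map
        (fun w => (!₂[∑ i, p i * w i, ∑ i, q i * w i] : EuclideanSpace ℝ (Fin 2)))) :=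
    Measure.isProbabilityMeasure_map hmeas.aemeasurable
  refine Measure.ext_of_charFun ?_
  ext t
  rw [charFun_multivariateGaussian (posSemidef_gram_two v p q), charFun_apply,
    integral_map hmeas.aemeasurable (by fun_prop)]
  have key := charFun_pi (ι := ι) (E := fun _ => ℝ) (μ := fun i => gaussianReal 0 (v i))
    (WithLp.toLp 2 fun i => t 0 * p i + t 1 * q i)
  rw [charFun_apply, integral_map (by fun_prop) (by fun_prop)] at key
  simp_rw [charFun_gaussianReal, ← Complex.exp_sum] at key
  convert key using 2
  · ext w
    congr 3
    simp [PiLp.inner_apply, Fin.sum_univ_two, Finset.mul_sum, ← Finset.sum_add_distrib]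
    refine Finset.sum_congr rfl fun i _ => ?_
    ring
  · simp [Matrix.mulVec, dotProduct, Fin.sum_univ_two, Finset.mul_sum, Finset.sum_mul,
        ← Finset.sum_add_distrib, Finset.sum_div]
    refine Finset.sum_congr rfl fun i _ => ?_
    ring

theorem integral_pi_gaussianReal_pair {ι : Type*} [Fintype ι] (v : ι → ℝ≥0) (p q : ι → ℝ)
    {σ : ℝ → ℝ} (hσ : Continuous σ) :
    ∫ w, σ (∑ i, p i * w i) * σ (∑ i, q i * w i) ∂(Measure.pi fun i => gaussianReal 0 (v i))
      = pairDual σ (∑ i, v i * p i ^ 2) (∑ i, v i * q i ^ 2) (∑ i, v i * (p i * q i)) := by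
  rw [pairDual, ← map_pi_gaussianReal_pair, integral_map (by fun_prop)
    (by have := hσ; exact Continuous.aestronglyMeasurable (by fun_prop))]
  simp

/-! ### Gaussian integration by parts -/

/-- **Stein's identity** for the standard Gaussian measure on the line. -/
theorem integral_id_mul_gaussianReal {f f' : ℝ → ℝ} {M M' : ℝ}
    (hf : ∀ x, HasDerivAt f (f' x) x) (hf' : Continuous f') (hM : ∀ x, |f x| ≤ M)
    (hM' : ∀ x, |f' x| ≤ M') :
    ∫ x, f x * x ∂(gaussianReal 0 1) = ∫ x, f' x ∂(gaussianReal 0 1) := by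
  have hfc : Continuous f := continuous_iff_continuousAt.2 fun x => (hf x).continuousAt
  have hpdf : gaussianPDFReal 0 1 = fun x => (√(2 * Real.pi))⁻¹ * Real.exp (-(1 / 2) * x ^ 2) := by
    ext x
    simp [gaussianPDFReal]
    ring_nf
    trivial
  have hderiv : ∀ x, HasDerivAt (gaussianPDFReal 0 1) (-(x * gaussianPDFReal 0 1 x)) x := by
    intro x
    rw [hpdf]
    have := (((hasDerivAt_pow 2 x).const_mul (-(1 / 2) : ℝ)).exp).const_mul (√(2 * Real.pi))⁻¹
    refine this.congr_deriv ?_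
    push_cast
    ring
  have hint := integrable_gaussianPDFReal 0 1
  have hint' : Integrable fun x => x * gaussianPDFReal 0 1 x := by
    rw [hpdf]
    have := (integrable_mul_exp_neg_mul_sq (b := 1 / 2) (by norm_num)).const_mul
      (√(2 * Real.pi))⁻¹
    refine this.congr (Filter.Eventually.of_forall fun x => ?_)
    ring
  have h := integral_mul_deriv_eq_deriv_mul_of_integrable (u := f) (v := gaussianPDFReal 0 1)
    (fun x _ => hf x) (fun x _ => hderiv x)
    (hint'.neg.bdd_mul (c := M) hfc.aestronglyMeasurable (Filter.Eventually.of_forall hM))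
    (hint.bdd_mul (c := M') hf'.aestronglyMeasurable (Filter.Eventually.of_forall hM'))
    (hint.bdd_mul (c := M) hfc.aestronglyMeasurable (Filter.Eventually.of_forall hM))
  rw [integral_gaussianReal_eq_integral_smul one_ne_zero,
    integral_gaussianReal_eq_integral_smul one_ne_zero]
  simp only [smul_eq_mul]
  calc ∫ x, gaussianPDFReal 0 1 x * (f x * x)
      = - ∫ x, f x * -(x * gaussianPDFReal 0 1 x) := by
        rw [← integral_neg]; congr 1; ext x; ring
    _ = ∫ x, f' x * gaussianPDFReal 0 1 x := by rw [h, neg_neg]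
    _ = _ := by congr 1; ext x; ring

/-- The standard Gaussian measure on `Fin m → ℝ`. -/
abbrev stdGaussianPi (m : ℕ) : Measure (Fin m → ℝ) := Measure.pi fun _ => gaussianReal 0 1

theorem integrable_eval_stdGaussianPi {m : ℕ} (k : Fin m) :
    Integrable (fun w => w k) (stdGaussianPi m) :=
  integrable_eval (μ := fun _ : Fin m => gaussianReal 0 1) (i := k) IsGaussian.integrable_id

theorem integral_mul_eval_stdGaussianPi {m : ℕ} (a b : Fin m → ℝ) {f f' g g' : ℝ → ℝ} {M : ℝ}
    (hf : ∀ x, HasDerivAt f (f' x) x) (hf' : Continuous f') (hfM : ∀ x, |f x| ≤ M)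
    (hfM' : ∀ x, |f' x| ≤ M)
    (hg : ∀ x, HasDerivAt g (g' x) x) (hg' : Continuous g') (hgM : ∀ x, |g x| ≤ M)
    (hgM' : ∀ x, |g' x| ≤ M) (k : Fin m) :
    ∫ w, (f (∑ i, a i * w i) * g (∑ i, b i * w i)) * w k ∂(stdGaussianPi m)
      = a k * ∫ w, f' (∑ i, a i * w i) * g (∑ i, b i * w i) ∂(stdGaussianPi m)
        + b k * ∫ w, f (∑ i, a i * w i) * g' (∑ i, b i * w i) ∂(stdGaussianPi m) := by
  have hfc : Continuous f := continuous_iff_continuousAt.2 fun x => (hf x).continuousAt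
  have hgc : Continuous g := continuous_iff_continuousAt.2 fun x => (hg x).continuousAt
  have hM : 0 ≤ M := (abs_nonneg _).trans (hfM 0)
  have hbd : ∀ {p q : ℝ → ℝ}, (∀ x, |p x| ≤ M) → (∀ x, |q x| ≤ M) → ∀ x y,
      |p x * q y| ≤ M * M := fun hp hq x y => by
    rw [abs_mul]; exact mul_le_mul (hp x) (hq y) (abs_nonneg _) hM
  have hint : ∀ {p q : ℝ → ℝ}, Continuous p → Continuous q → (∀ x, |p x| ≤ M) →
      (∀ x, |q x| ≤ M) →
      Integrable (fun w => p (∑ i, a i * w i) * q (∑ i, b i * w i)) (stdGaussianPi m) := by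
    intro p q hpc hqc hp hq
    exact Integrable.of_bound (C := M * M) (Continuous.aestronglyMeasurable (by fun_prop))
      (Filter.Eventually.of_forall fun w => hbd hp hq _ _)
  have hi1 := hint hf' hgc hfM' hgM
  have hi2 := hint hfc hg' hfM hgM'
  rw [← integral_const_mul, ← integral_const_mul, ← integral_add (hi1.const_mul _)
    (hi2.const_mul _)]
  obtain ⟨m, rfl⟩ : ∃ m', m = m' + 1 := ⟨m - 1, by have := k.2; omega⟩
  -- Split off coordinate `k`; with the others frozen, the integrand is a function of one Gaussian
  -- variable and the one-dimensional identity applies.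
  have hmp := (measurePreserving_piFinSuccAbove (fun _ : Fin (m + 1) => gaussianReal 0 1) k).symm
  have e1 := hmp.integral_comp' (fun w => (f (∑ i, a i * w i) * g (∑ i, b i * w i)) * w k)
  have e2 := hmp.integral_comp' (fun w => a k * (f' (∑ i, a i * w i) * g (∑ i, b i * w i)) +
    b k * (f (∑ i, a i * w i) * g' (∑ i, b i * w i)))
  rw [← e1, ← e2]
  have hI1 : Integrable (fun w => (f (∑ i, a i * w i) * g (∑ i, b i * w i)) * w k)
      (stdGaussianPi (m + 1)) :=
    (integrable_eval_stdGaussianPi k).bdd_mul (c := M * M)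
      (Continuous.aestronglyMeasurable (by fun_prop))
      (Filter.Eventually.of_forall fun w => hbd hfM hgM _ _)
  have hJ1 := (hmp.integrable_comp_emb (MeasurableEquiv.measurableEmbedding _)).2 hI1
  have hJ2 := (hmp.integrable_comp_emb (MeasurableEquiv.measurableEmbedding _)).2
    ((hi1.const_mul (a k)).add (hi2.const_mul (b k)))
  simp only [Function.comp_def, Pi.add_apply] at hJ1 hJ2
  rw [integral_prod_symm _ hJ1, integral_prod_symm _ hJ2]
  congr 1
  ext y
  simp only [MeasurableEquiv.piFinSuccAbove_symm_apply, Fin.insertNthEquiv, Equiv.coe_fn_mk,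
    Fin.sum_univ_succAbove _ k, Fin.insertNth_apply_same, Fin.insertNth_apply_succAbove]
  have hlin : ∀ (c s : ℝ) (x : ℝ), HasDerivAt (fun t => c * t + s) c x := fun c s x => by
    simpa using ((hasDerivAt_id x).const_mul c).add_const s
  refine integral_id_mul_gaussianReal (M := M * M) (M' := |a k| * (M * M) + |b k| * (M * M))
    (fun x => ?_) (by fun_prop) (fun x => hbd hfM hgM _ _) (fun x => ?_)
  · have h1 := (hf _).comp x (hlin (a k) (∑ i, a (k.succAbove i) * y i) x)
    have h2 := (hg _).comp x (hlin (b k) (∑ i, b (k.succAbove i) * y i) x)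
    refine (h1.mul h2).congr_deriv ?_
    simp only [Function.comp_apply]
    ring
  · refine (abs_add_le _ _).trans ?_
    rw [abs_mul (a k), abs_mul (b k)]
    exact add_le_add (mul_le_mul_of_nonneg_left (hbd hfM' hgM _ _) (abs_nonneg _))
      (mul_le_mul_of_nonneg_left (hbd hfM hgM' _ _) (abs_nonneg _))

theorem abs_integral_mul_le {Ω : Type*} [MeasurableSpace Ω] (μ : Measure Ω)
    [IsProbabilityMeasure μ] {f g : Ω → ℝ} {M : ℝ} (hf : ∀ x, |f x| ≤ M) (hg : ∀ x, |g x| ≤ M) :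
    |∫ x, f x * g x ∂μ| ≤ M ^ 2 := by
  have := norm_integral_le_of_norm_le_const (μ := μ) (f := fun x => f x * g x) (C := M ^ 2)
    (Filter.Eventually.of_forall fun x => by
      rw [Real.norm_eq_abs, abs_mul, sq]
      exact mul_le_mul (hf x) (hg x) (abs_nonneg _) ((abs_nonneg _).trans (hf x)))
  simpa using this

/-- A curve of pairs of linear forms in independent standard Gaussians: the derivative of
`𝔼 σ(⟨a, w⟩) σ(⟨b, w⟩)` after integration by parts. -/
theorem hasDerivAt_integral_stdGaussianPi {m : ℕ} {σ σ' σ'' : ℝ → ℝ} {M K : ℝ}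
    (h1 : ∀ x, HasDerivAt σ (σ' x) x) (h2 : ∀ x, HasDerivAt σ' (σ'' x) x) (h3 : Continuous σ'')
    (hM : ∀ x, |σ x| ≤ M) (hM' : ∀ x, |σ' x| ≤ M) (hM'' : ∀ x, |σ'' x| ≤ M)
    {a b a' b' : ℝ → Fin m → ℝ} (ha : ∀ t i, HasDerivAt (fun t => a t i) (a' t i) t)
    (hb : ∀ t i, HasDerivAt (fun t => b t i) (b' t i) t)
    (haK : ∀ t i, |a' t i| ≤ K) (hbK : ∀ t i, |b' t i| ≤ K) (t : ℝ) :
    HasDerivAt (fun t => ∫ w, σ (∑ i, a t i * w i) * σ (∑ i, b t i * w i) ∂(stdGaussianPi m))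
      ((∑ i, a' t i * a t i) *
          (∫ w, σ'' (∑ i, a t i * w i) * σ (∑ i, b t i * w i) ∂(stdGaussianPi m))
        + (∑ i, (a' t i * b t i + b' t i * a t i)) *
          (∫ w, σ' (∑ i, a t i * w i) * σ' (∑ i, b t i * w i) ∂(stdGaussianPi m))
        + (∑ i, b' t i * b t i) *
          (∫ w, σ (∑ i, a t i * w i) * σ'' (∑ i, b t i * w i) ∂(stdGaussianPi m))) t := by
  have hc : Continuous σ := continuous_iff_continuousAt.2 fun x => (h1 x).continuousAt
  have hc' : Continuous σ' := continuous_iff_continuousAt.2 fun x => (h2 x).continuousAt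
  have hM0 : 0 ≤ M := (abs_nonneg _).trans (hM 0)
  have hlin : ∀ {p p' : ℝ → Fin m → ℝ}, (∀ t i, HasDerivAt (fun t => p t i) (p' t i) t) →
      ∀ (w : Fin m → ℝ) s, HasDerivAt (fun t => ∑ i, p t i * w i) (∑ i, p' s i * w i) s :=
    fun hp w s => HasDerivAt.fun_sum fun i _ => (hp s i).mul_const _
  -- The uniform bound `K` on the velocities yields a dominating function independent of the time
  -- parameter.
  have hbl : ∀ {p' : ℝ → Fin m → ℝ}, (∀ t i, |p' t i| ≤ K) → ∀ (w : Fin m → ℝ) s,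
      |∑ i, p' s i * w i| ≤ ∑ i, K * |w i| := fun hp w s => by
    refine (Finset.abs_sum_le_sum_abs _ _).trans (Finset.sum_le_sum fun i _ => ?_)
    rw [abs_mul]
    exact mul_le_mul_of_nonneg_right (hp s i) (abs_nonneg _)
  have key := (hasDerivAt_integral_of_dominated_loc_of_deriv_le (μ := stdGaussianPi m) (x₀ := t)
    (s := Set.univ)
    (F := fun t w => σ (∑ i, a t i * w i) * σ (∑ i, b t i * w i))
    (F' := fun t w => σ' (∑ i, a t i * w i) * (∑ i, a' t i * w i) * σ (∑ i, b t i * w i)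
      + σ (∑ i, a t i * w i) * (σ' (∑ i, b t i * w i) * (∑ i, b' t i * w i)))
    (bound := fun w => M * (∑ i, K * |w i|) * M + M * (M * ∑ i, K * |w i|))
    Filter.univ_mem
    (Filter.Eventually.of_forall fun s => Continuous.aestronglyMeasurable (by fun_prop))
    (Integrable.of_bound (C := M * M) (Continuous.aestronglyMeasurable (by fun_prop))
      (Filter.Eventually.of_forall fun w => by
        rw [Real.norm_eq_abs, abs_mul]
        exact mul_le_mul (hM _) (hM _) (abs_nonneg _) hM0))
    (Continuous.aestronglyMeasurable (by fun_prop))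
    (Filter.Eventually.of_forall fun w s _ => by
      refine (norm_add_le _ _).trans (add_le_add ?_ ?_)
      · rw [Real.norm_eq_abs, abs_mul, abs_mul]
        have := hbl haK w s
        have := (abs_nonneg _).trans this
        gcongr
        · exact hM' _
        · exact hM _
      · rw [Real.norm_eq_abs, abs_mul, abs_mul]
        have := hbl hbK w s
        gcongr
        · exact hM _
        · exact hM' _)
    (by
      have : Integrable (fun w : Fin m → ℝ => ∑ i, K * |w i|) (stdGaussianPi m) :=
        integrable_finsetSum _ fun i _ => (integrable_eval_stdGaussianPi i).abs.const_mul K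
      exact ((this.const_mul M).mul_const M).add ((this.const_mul M).const_mul M))
    (Filter.Eventually.of_forall fun w s _ =>
      ((h1 _).comp s (hlin ha w s)).mul ((h1 _).comp s (hlin hb w s)))).2
  refine key.congr_deriv ?_
  have hI : ∀ {p q : ℝ → ℝ}, Continuous p → Continuous q → (∀ x, |p x| ≤ M) →
      (∀ x, |q x| ≤ M) → ∀ i,
      Integrable (fun w => (p (∑ i, a t i * w i) * q (∑ i, b t i * w i)) * w i)
        (stdGaussianPi m) := by
    intro p q hpc hqc hp hq i
    exact (integrable_eval_stdGaussianPi i).bdd_mul (c := M * M)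
      (Continuous.aestronglyMeasurable (by fun_prop))
      (Filter.Eventually.of_forall fun w => by
        rw [Real.norm_eq_abs, abs_mul]
        exact mul_le_mul (hp _) (hq _) (abs_nonneg _) hM0)
  -- Expanding the linear forms produced by the chain rule leaves bounded products times one
  -- coordinate `w i`, the shape required by Stein's identity.
  have e : (fun w : Fin m → ℝ =>
      σ' (∑ i, a t i * w i) * (∑ i, a' t i * w i) * σ (∑ i, b t i * w i)
      + σ (∑ i, a t i * w i) * (σ' (∑ i, b t i * w i) * (∑ i, b' t i * w i)))
      = fun w => ∑ i, (a' t i * ((σ' (∑ i, a t i * w i) * σ (∑ i, b t i * w i)) * w i)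
        + b' t i * ((σ (∑ i, a t i * w i) * σ' (∑ i, b t i * w i)) * w i)) := by
    ext w
    rw [Finset.sum_add_distrib]
    congr 1
    · rw [mul_right_comm, Finset.mul_sum]
      exact Finset.sum_congr rfl fun i _ => by ring
    · rw [← mul_assoc, Finset.mul_sum]
      exact Finset.sum_congr rfl fun i _ => by ring
  rw [e, integral_finsetSum]
  swap
  · exact fun i _ => ((hI hc' hc hM' hM i).const_mul _).add ((hI hc hc' hM hM' i).const_mul _)
  rw [Finset.sum_mul, Finset.sum_mul, Finset.sum_mul, ← Finset.sum_add_distrib,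
    ← Finset.sum_add_distrib]
  refine Finset.sum_congr rfl fun i _ => ?_
  rw [integral_add ((hI hc' hc hM' hM i).const_mul _) ((hI hc hc' hM hM' i).const_mul _),
    integral_const_mul, integral_const_mul,
    integral_mul_eval_stdGaussianPi (a t) (b t) h2 h3 hM' hM'' h1 hc' hM hM' i,
    integral_mul_eval_stdGaussianPi (a t) (b t) h1 hc' hM hM' h2 h3 hM' hM'' i]
  ring

/-! ### Lipschitz dependence of the dual on the covariance -/

/-- Orthogonality makes the primed and unprimed Gaussian pairs independent. Rotating one into the
other changes the covariance only through the differences of Gram entries, and integration by parts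
turns this into a bound using two derivatives of `σ`. -/
theorem abs_integral_sub_le_of_orthogonal {m : ℕ} {σ σ' σ'' : ℝ → ℝ} {M η : ℝ}
    (h1 : ∀ x, HasDerivAt σ (σ' x) x) (h2 : ∀ x, HasDerivAt σ' (σ'' x) x) (h3 : Continuous σ'')
    (hM : ∀ x, |σ x| ≤ M) (hM' : ∀ x, |σ' x| ≤ M) (hM'' : ∀ x, |σ'' x| ≤ M)
    (p q p' q' : Fin m → ℝ) (hpp : ∑ i, p i * p' i = 0) (hpq : ∑ i, p i * q' i = 0)
    (hqp : ∑ i, q i * p' i = 0) (hqq : ∑ i, q i * q' i = 0)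
    (hp : |∑ i, p i * p i - ∑ i, p' i * p' i| ≤ η) (hq : |∑ i, q i * q i - ∑ i, q' i * q' i| ≤ η)
    (hr : |∑ i, p i * q i - ∑ i, p' i * q' i| ≤ η) :
    |∫ w, σ (∑ i, p i * w i) * σ (∑ i, q i * w i) ∂(stdGaussianPi m)
      - ∫ w, σ (∑ i, p' i * w i) * σ (∑ i, q' i * w i) ∂(stdGaussianPi m)| ≤ 2 * M ^ 2 * η := by
  set a : ℝ → Fin m → ℝ := fun t i => Real.sin t * p i + Real.cos t * p' i with ha_def
  set b : ℝ → Fin m → ℝ := fun t i => Real.sin t * q i + Real.cos t * q' i with hb_def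
  set a' : ℝ → Fin m → ℝ := fun t i => Real.cos t * p i + (-Real.sin t) * p' i with ha'_def
  set b' : ℝ → Fin m → ℝ := fun t i => Real.cos t * q i + (-Real.sin t) * q' i with hb'_def
  have ha : ∀ t i, HasDerivAt (fun t => a t i) (a' t i) t := fun t i =>
    ((Real.hasDerivAt_sin t).mul_const _).add ((Real.hasDerivAt_cos t).mul_const _)
  have hb : ∀ t i, HasDerivAt (fun t => b t i) (b' t i) t := fun t i =>
    ((Real.hasDerivAt_sin t).mul_const _).add ((Real.hasDerivAt_cos t).mul_const _)
  set K : ℝ := ∑ i, (|p i| + |p' i| + |q i| + |q' i|)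
  have hKi : ∀ i, |p i| + |p' i| + |q i| + |q' i| ≤ K := fun i =>
    Finset.single_le_sum (f := fun i => |p i| + |p' i| + |q i| + |q' i|)
      (fun i _ => by positivity) (Finset.mem_univ i)
  have htrig : ∀ t x y : ℝ, |Real.cos t * x + (-Real.sin t) * y| ≤ |x| + |y| := fun t x y => by
    refine (abs_add_le _ _).trans (add_le_add ?_ ?_)
    · rw [abs_mul]
      exact mul_le_of_le_one_left (abs_nonneg _) (Real.abs_cos_le_one t)
    · rw [abs_mul, abs_neg]
      exact mul_le_of_le_one_left (abs_nonneg _) (Real.abs_sin_le_one t)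
  have haK : ∀ t i, |a' t i| ≤ K := fun t i => by
    have := hKi i
    have := htrig t (p i) (p' i)
    have := abs_nonneg (q i)
    have := abs_nonneg (q' i)
    linarith
  have hbK : ∀ t i, |b' t i| ≤ K := fun t i => by
    have := hKi i
    have := htrig t (q i) (q' i)
    have := abs_nonneg (p i)
    have := abs_nonneg (p' i)
    linarith
  have hder := hasDerivAt_integral_stdGaussianPi h1 h2 h3 hM hM' hM'' ha hb haK hbK
  have comb : ∀ (x y z u : ℝ) (f g h k : Fin m → ℝ),
      ∑ i, (x * f i + y * g i) * (z * h i + u * k i) = x * z * ∑ i, f i * h i +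
        x * u * ∑ i, f i * k i + y * z * ∑ i, h i * g i + y * u * ∑ i, g i * k i := by
    intro x y z u f g h k
    simp only [Finset.mul_sum, ← Finset.sum_add_distrib]
    exact Finset.sum_congr rfl fun i _ => by ring
  -- In these inner products the cross terms vanish by orthogonality, leaving `sin t * cos t` times
  -- a difference of covariances.
  have s1 : ∀ t, ∑ i, a' t i * a t i
      = Real.sin t * Real.cos t * (∑ i, p i * p i - ∑ i, p' i * p' i) := fun t => by
    simp only [ha_def, ha'_def, comb, hpp]
    ring
  have s3 : ∀ t, ∑ i, b' t i * b t i
      = Real.sin t * Real.cos t * (∑ i, q i * q i - ∑ i, q' i * q' i) := fun t => by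
    simp only [hb_def, hb'_def, comb, hqq]
    ring
  have s2 : ∀ t, ∑ i, (a' t i * b t i + b' t i * a t i)
      = 2 * (Real.sin t * Real.cos t) * (∑ i, p i * q i - ∑ i, p' i * q' i) := fun t => by
    have e1 : ∑ i, q i * p i = ∑ i, p i * q i := Finset.sum_congr rfl fun i _ => mul_comm _ _
    have e2 : ∑ i, q' i * p' i = ∑ i, p' i * q' i := Finset.sum_congr rfl fun i _ => mul_comm _ _
    rw [Finset.sum_add_distrib]
    simp only [ha_def, hb_def, hb'_def, ha'_def, comb, hpq, hqp, e1, e2]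
    ring
  have hη : 0 ≤ η := (abs_nonneg _).trans hp
  -- The derivative is at most `4 * η * M ^ 2 * sin t * cos t`, which is exactly the derivative of
  -- the barrier `2 * M ^ 2 * η * sin t ^ 2`; the barrier ends at `2 * M ^ 2 * η`.
  have main := image_norm_le_of_norm_deriv_right_le_deriv_boundary
    (f := fun t => ∫ w, σ (∑ i, a t i * w i) * σ (∑ i, b t i * w i) ∂(stdGaussianPi m)
      - ∫ w, σ (∑ i, a 0 i * w i) * σ (∑ i, b 0 i * w i) ∂(stdGaussianPi m))
    (a := 0) (b := Real.pi / 2)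
    (B := fun t => 2 * M ^ 2 * η * Real.sin t ^ 2)
    (B' := fun t => 2 * M ^ 2 * η * (2 * Real.sin t * Real.cos t))
    (fun t _ => ((hder t).sub_const _).continuousAt.continuousWithinAt)
    (fun t _ => ((hder t).sub_const _).hasDerivWithinAt)
    (by simp)
    (fun t => by
      have := (((Real.hasDerivAt_sin t).pow 2).const_mul (2 * M ^ 2 * η))
      refine this.congr_deriv ?_
      simp)
    (fun t ht => by
      rw [s1, s2, s3, Real.norm_eq_abs]
      have hs : 0 ≤ Real.sin t * Real.cos t := mul_nonneg
        (Real.sin_nonneg_of_nonneg_of_le_pi ht.1 (by linarith [ht.2, Real.pi_pos]))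
        (Real.cos_nonneg_of_mem_Icc ⟨by linarith [ht.1, Real.pi_pos], ht.2.le⟩)
      have i1 := abs_integral_mul_le (stdGaussianPi m)
        (fun w => hM'' (∑ i, a t i * w i)) (fun w => hM (∑ i, b t i * w i))
      have i2 := abs_integral_mul_le (stdGaussianPi m)
        (fun w => hM' (∑ i, a t i * w i)) (fun w => hM' (∑ i, b t i * w i))
      have i3 := abs_integral_mul_le (stdGaussianPi m)
        (fun w => hM (∑ i, a t i * w i)) (fun w => hM'' (∑ i, b t i * w i))
      have hm : ∀ {x y : ℝ}, |x| ≤ η → |y| ≤ M ^ 2 → |x * y| ≤ η * M ^ 2 := fun hx hy => by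
        rw [abs_mul]; exact mul_le_mul hx hy (abs_nonneg _) hη
      have j1 := abs_le.1 (hm hp i1)
      have j2 := abs_le.1 (hm hr i2)
      have j3 := abs_le.1 (hm hq i3)
      generalize (∑ i, p i * p i - ∑ i, p' i * p' i) = A at *
      generalize (∑ i, p i * q i - ∑ i, p' i * q' i) = B at *
      generalize (∑ i, q i * q i - ∑ i, q' i * q' i) = D at *
      generalize (∫ w, σ'' (∑ i, a t i * w i) * σ (∑ i, b t i * w i) ∂(stdGaussianPi m)) = x at *
      generalize (∫ w, σ' (∑ i, a t i * w i) * σ' (∑ i, b t i * w i) ∂(stdGaussianPi m)) = y at *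
      generalize (∫ w, σ (∑ i, a t i * w i) * σ'' (∑ i, b t i * w i) ∂(stdGaussianPi m)) = z at *
      have : Real.sin t * Real.cos t * A * x + 2 * (Real.sin t * Real.cos t) * B * y
          + Real.sin t * Real.cos t * D * z
          = Real.sin t * Real.cos t * (A * x + 2 * (B * y) + D * z) := by ring
      rw [this, abs_mul, abs_of_nonneg hs]
      have h4 : |A * x + 2 * (B * y) + D * z| ≤ 4 * (η * M ^ 2) :=
        abs_le.2 ⟨by linarith [j1.1, j2.1, j3.1], by linarith [j1.2, j2.2, j3.2]⟩
      calc _ ≤ Real.sin t * Real.cos t * (4 * (η * M ^ 2)) := mul_le_mul_of_nonneg_left h4 hs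
        _ = _ := by ring)
    (x := Real.pi / 2) ⟨by positivity, le_rfl⟩
  simpa [ha_def, hb_def] using main

/-- Cholesky factorization of a positive semidefinite 2×2 matrix; when `s = 0` the determinant
condition forces `c = 0`. -/
theorem exists_fin_two_gram {s t c : ℝ} (hs : 0 ≤ s) (hc : c ^ 2 ≤ s * t) (ht : 0 ≤ t) :
    ∃ p q : Fin 2 → ℝ, p 0 * p 0 + p 1 * p 1 = s ∧ q 0 * q 0 + q 1 * q 1 = t ∧
      p 0 * q 0 + p 1 * q 1 = c := by
  rcases hs.eq_or_lt with rfl | hs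
  · have : c = 0 := by
      have : c ^ 2 = 0 := le_antisymm (by simpa using hc) (sq_nonneg c)
      simpa using this
    exact ⟨![0, 0], ![√t, 0], by simp, by simp [Real.mul_self_sqrt ht], by simp [this]⟩
  · refine ⟨![√s, 0], ![c / √s, √(t - c ^ 2 / s)], by simp [Real.mul_self_sqrt hs.le], ?_, ?_⟩
    · have h0 : 0 ≤ t - c ^ 2 / s := by
        rw [sub_nonneg, div_le_iff₀ hs]; linarith
      simp only [Matrix.cons_val_zero, Matrix.cons_val_one, Real.mul_self_sqrt h0]
      rw [div_mul_div_comm, Real.mul_self_sqrt hs.le]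
      ring
    · have := (Real.sqrt_pos.2 hs).ne'
      simp
      field_simp

theorem pairDual_eq_integral_stdGaussianPi {m : ℕ} {σ : ℝ → ℝ} (hσ : Continuous σ)
    (p q : Fin m → ℝ) :
    ∫ w, σ (∑ i, p i * w i) * σ (∑ i, q i * w i) ∂(stdGaussianPi m)
      = pairDual σ (∑ i, p i * p i) (∑ i, q i * q i) (∑ i, p i * q i) := by
  have := integral_pi_gaussianReal_pair (fun _ => 1) p q hσ
  simpa [sq] using this

/-- The dual of a function with bounded derivatives is Lipschitz in the covariance matrix. -/
theorem abs_pairDual_sub_le {σ : ℝ → ℝ} {M η : ℝ} (hσ : ContDiff ℝ 2 σ)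
    (hM : ∀ x, |σ x| ≤ M) (hM' : ∀ x, |deriv σ x| ≤ M) (hM'' : ∀ x, |deriv (deriv σ) x| ≤ M)
    {s t c s' t' c' : ℝ} (hs : 0 ≤ s) (ht : 0 ≤ t) (hc : c ^ 2 ≤ s * t)
    (hs' : 0 ≤ s') (ht' : 0 ≤ t') (hc' : c' ^ 2 ≤ s' * t')
    (hss : |s - s'| ≤ η) (htt : |t - t'| ≤ η) (hcc : |c - c'| ≤ η) :
    |pairDual σ s t c - pairDual σ s' t' c'| ≤ 2 * M ^ 2 * η := by
  obtain ⟨p, q, hp, hq, hpq⟩ := exists_fin_two_gram hs hc ht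
  obtain ⟨p', q', hp', hq', hpq'⟩ := exists_fin_two_gram hs' hc' ht'
  have hd1 : ContDiff ℝ 1 (deriv σ) := by
    have : ContDiff ℝ (1 + 1) σ := by simpa [one_add_one_eq_two] using hσ
    exact (contDiff_succ_iff_deriv.1 this).2.2
  have hd2 : Continuous (deriv (deriv σ)) := hd1.continuous_deriv le_rfl
  -- Padding with zeros puts the two factorizations in complementary coordinate planes of `ℝ⁴`, so
  -- all four orthogonality conditions hold.
  have h := abs_integral_sub_le_of_orthogonal (η := η)
    (fun x => (hσ.differentiable (by norm_num) x).hasDerivAt)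
    (fun x => (hd1.differentiable (by norm_num) x).hasDerivAt) hd2 hM hM' hM''
    ![p 0, p 1, 0, 0] ![q 0, q 1, 0, 0] ![0, 0, p' 0, p' 1] ![0, 0, q' 0, q' 1]
    (by simp [Fin.sum_univ_four]) (by simp [Fin.sum_univ_four]) (by simp [Fin.sum_univ_four])
    (by simp [Fin.sum_univ_four])
    (by simpa [Fin.sum_univ_four, hp, hp'] using hss)
    (by simpa [Fin.sum_univ_four, hq, hq'] using htt)
    (by simpa [Fin.sum_univ_four, hpq, hpq'] using hcc)
  rw [pairDual_eq_integral_stdGaussianPi hσ.continuous,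
    pairDual_eq_integral_stdGaussianPi hσ.continuous] at h
  simpa [Fin.sum_univ_four, hp, hp', hq, hq', hpq, hpq'] using h

/-! ### Concentration of one layer -/

/-- **Hoeffding's inequality** for the empirical mean of independent bounded variables. -/
theorem measureReal_lt_abs_mean_sub_le {Ω : Type*} [MeasurableSpace Ω] {μ : Measure Ω}
    [IsProbabilityMeasure μ] {r : ℕ} (hr : 0 < r) {X : Fin r → Ω → ℝ} (hX : iIndepFun X μ)
    (hXm : ∀ j, AEMeasurable (X j) μ) {L m η : ℝ} (hL : ∀ j ω, |X j ω| ≤ L)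
    (hm : ∀ j, ∫ ω, X j ω ∂μ = m) (hη : 0 ≤ η) :
    μ.real {ω | η < |(∑ j, X j ω) / r - m|} ≤ 2 * Real.exp (-(r * η ^ 2 / (2 * L ^ 2))) := by
  have hr0 : (0 : ℝ) < r := by exact_mod_cast hr
  have hL0 : 0 ≤ L := by
    obtain ⟨ω⟩ := nonempty_of_isProbabilityMeasure μ
    exact (abs_nonneg _).trans (hL ⟨0, hr⟩ ω)
  -- Hoeffding's lemma on `[-L, L]`: the variance proxy is `L ^ 2`. The negated family below handles
  -- the lower tail.
  have hsub : ∀ j, HasSubgaussianMGF (fun ω => X j ω - m) ((‖L - -L‖₊ / 2) ^ 2) μ := fun j => by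
    have := hasSubgaussianMGF_of_mem_Icc (hXm j) (a := -L) (b := L)
      (Filter.Eventually.of_forall fun ω => abs_le.1 (hL j ω))
    rwa [hm] at this
  have hind : iIndepFun (fun j ω => X j ω - m) μ :=
    hX.comp (fun _ x => x - m) fun _ => by fun_prop
  have hind' : iIndepFun (fun j => -(fun ω => X j ω - m)) μ :=
    hX.comp (fun _ x => -(x - m)) fun _ => by fun_prop
  have hsum : ((∑ j : Fin r, ((‖L - -L‖₊ / 2) ^ 2 : ℝ≥0) : ℝ≥0) : ℝ) = r * L ^ 2 := by
    simp only [Finset.sum_const, Finset.card_univ, Fintype.card_fin, nsmul_eq_mul, NNReal.coe_mul,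
      NNReal.coe_natCast, NNReal.coe_pow, NNReal.coe_div, coe_nnnorm, Real.norm_eq_abs]
    rw [sub_neg_eq_add, ← two_mul, abs_of_nonneg (by positivity)]
    simp
  have hexp : -(r * η) ^ 2 / (2 * (r * L ^ 2)) = -(r * η ^ 2 / (2 * L ^ 2)) := by
    rcases hL0.eq_or_lt with rfl | hL0
    · simp
    · field_simp
  have h1 := HasSubgaussianMGF.measure_sum_ge_le_of_iIndepFun hind (s := Finset.univ)
    (fun j _ => hsub j) (ε := r * η) (by positivity)
  have h2 := HasSubgaussianMGF.measure_sum_ge_le_of_iIndepFun hind' (s := Finset.univ)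
    (fun j _ => (hsub j).neg) (ε := r * η) (by positivity)
  push_cast at h1 h2 hsum
  rw [hsum, hexp] at h1 h2
  have hset : {ω | η < |(∑ j, X j ω) / r - m|} ⊆
      {ω | r * η ≤ ∑ j, (X j ω - m)} ∪
        {ω | r * η ≤ ∑ j, (-(fun ω => X j ω - m)) ω} := by
    intro ω hω
    rw [Set.mem_ofPred_eq] at hω
    have e : ∑ j, (X j ω - m) = r * ((∑ j, X j ω) / r - m) := by
      rw [Finset.sum_sub_distrib]
      simp
      field_simp
    simp only [Set.mem_union, Set.mem_ofPred_eq, Pi.neg_apply, Finset.sum_neg_distrib, e]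
    rw [← mul_neg, mul_le_mul_iff_right₀ hr0, mul_le_mul_iff_right₀ hr0]
    rcases lt_abs.1 hω with h | h
    · exact Or.inl h.le
    · exact Or.inr h.le
  refine (measureReal_mono hset).trans ((measureReal_union_le _ _).trans ?_)
  rw [two_mul]
  exact add_le_add h1 h2

/-- A product measure is the product, over the fibres of a map, of the products over the fibres. -/
theorem measurePreserving_pi_fibers {E J : Type*} [Fintype E] [Fintype J] [DecidableEq J]
    (f : E → J) (μ : E → Measure ℝ) [∀ e, IsProbabilityMeasure (μ e)] :
    MeasurePreserving (fun (g : ∀ j, {e // f e = j} → ℝ) (e : E) => g (f e) ⟨e, rfl⟩)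
      (Measure.pi fun j => Measure.pi fun e : {e // f e = j} => μ e) (Measure.pi μ) := by
  have hmeas : Measurable
      (fun (g : ∀ j, {e // f e = j} → ℝ) (e : E) => g (f e) ⟨e, rfl⟩) := by
    refine measurable_pi_lambda _ fun e => ?_
    exact (measurable_pi_apply _).comp (measurable_pi_apply (f e))
  refine ⟨hmeas, (Measure.pi_eq fun s hs => ?_).symm⟩
  rw [Measure.map_apply hmeas (MeasurableSet.univ_pi hs)]
  have : (fun (g : ∀ j, {e // f e = j} → ℝ) (e : E) => g (f e) ⟨e, rfl⟩) ⁻¹' Set.univ.pi s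
      = Set.univ.pi fun j => Set.univ.pi fun e : {e // f e = j} => s e := by
    ext g
    simp only [Set.mem_preimage, Set.mem_pi, Set.mem_univ, true_imp_iff]
    constructor
    · rintro h j ⟨e, rfl⟩
      exact h e
    · intro h e
      exact h (f e) ⟨e, rfl⟩
  rw [this, Measure.pi_pi]
  simp_rw [Measure.pi_pi]
  rw [← Fintype.prod_sigma', ← (Equiv.sigmaFiberEquiv f).prod_comp]
  rfl

/-- Concentration of the empirical dual of a layer of neurons `j : Fin r` that have independent
Gaussian weights, where the weights of the neuron `j` are those in the fibre of `f` over `j`. -/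
theorem measureReal_layer_le {E : Type*} [Fintype E] {r : ℕ} (hr : 0 < r) (f : E → Fin r)
    (v : E → ℝ≥0) (p q : E → ℝ) {σ : ℝ → ℝ} (hσ : Continuous σ) {M : ℝ} (hM : ∀ x, |σ x| ≤ M)
    {s t c η : ℝ} (hs : ∀ j, ∑ e : {e // f e = j}, v e * p e ^ 2 = s)
    (ht : ∀ j, ∑ e : {e // f e = j}, v e * q e ^ 2 = t)
    (hc : ∀ j, ∑ e : {e // f e = j}, v e * (p e * q e) = c) (hη : 0 ≤ η) :
    (Measure.pi fun e => gaussianReal 0 (v e)).real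
      {w | η < |(∑ j, σ (∑ e : {e // f e = j}, p e * w e) * σ (∑ e : {e // f e = j}, q e * w e)) / r
        - pairDual σ s t c|} ≤ 2 * Real.exp (-(r * η ^ 2 / (2 * (M ^ 2) ^ 2))) := by
  have hmp := measurePreserving_pi_fibers f fun e => gaussianReal 0 (v e)
  have hopen : IsOpen {w : E → ℝ | η < |(∑ j, σ (∑ e : {e // f e = j}, p e * w e) *
      σ (∑ e : {e // f e = j}, q e * w e)) / r - pairDual σ s t c|} :=
    isOpen_lt continuous_const (by fun_prop)
  -- After regrouping the weights by fibre, each neuron reads its own factor of the product measure,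
  -- which gives independence.
  rw [measureReal_def, ← hmp.measure_preimage hopen.measurableSet.nullMeasurableSet,
    ← measureReal_def]
  have hind := iIndepFun_pi
    (μ := fun j => Measure.pi fun e : {e // f e = j} => gaussianReal 0 (v e))
    (X := fun j (g : {e // f e = j} → ℝ) => σ (∑ e : {e // f e = j}, p e * g e) * σ (∑ e : {e // f e = j}, q e * g e))
    (fun j => Continuous.aemeasurable (by fun_prop))
  refine (measureReal_mono ?_).trans (measureReal_lt_abs_mean_sub_le hr hind
    (fun j => Continuous.aemeasurable (by fun_prop)) (L := M ^ 2) (m := pairDual σ s t c)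
    (fun j ω => ?_) (fun j => ?_) hη)
  · intro g hg
    simp only [Set.mem_preimage, Set.mem_ofPred_eq] at hg ⊢
    convert hg using 6 with j
    · refine congrArg σ (Finset.sum_congr rfl ?_)
      rintro ⟨e, rfl⟩ -
      rfl
    · refine congrArg σ (Finset.sum_congr rfl ?_)
      rintro ⟨e, rfl⟩ -
      rfl
  · rw [abs_mul, sq]
    exact mul_le_mul (hM _) (hM _) (abs_nonneg _) ((abs_nonneg _).trans (hM 0))
  · have h := integral_pi_gaussianReal_pair (fun e : {e // f e = j} => v e) (fun e => p e)
      (fun e => q e) hσ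
    rw [hs, ht, hc] at h
    rw [← h]
    exact integral_comp_eval
      (μ := fun j => Measure.pi fun e : {e // f e = j} => gaussianReal 0 (v e)) (i := j)
      (f := fun g : {e // f e = j} → ℝ => σ (∑ e : {e // f e = j}, p e * g e) * σ (∑ e : {e // f e = j}, q e * g e))
      (Continuous.aestronglyMeasurable (by fun_prop))

/-! ### Covariance triples and normalized activations -/

/-- The covariance parameters of a centred Gaussian pair. -/
def IsCovTriple (s t c : ℝ) : Prop := 0 ≤ s ∧ 0 ≤ t ∧ c ^ 2 ≤ s * t

theorem isCovTriple_sum {ι : Type*} [Fintype ι] {v : ι → ℝ} (hv : ∀ i, 0 ≤ v i) (p q : ι → ℝ) :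
    IsCovTriple (∑ i, v i * (p i * p i)) (∑ i, v i * (q i * q i)) (∑ i, v i * (p i * q i)) := by
  refine ⟨Finset.sum_nonneg fun i _ => mul_nonneg (hv i) (mul_self_nonneg _),
    Finset.sum_nonneg fun i _ => mul_nonneg (hv i) (mul_self_nonneg _),
    Finset.sum_sq_le_sum_mul_sum_of_sq_le_mul _
      (fun i _ => mul_nonneg (hv i) (mul_self_nonneg _))
      (fun i _ => mul_nonneg (hv i) (mul_self_nonneg _)) fun i _ => le_of_eq (by ring)⟩

/-- A `C²` function bounded by `M` together with its first two derivatives. -/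
structure IsSmoothBounded (M : ℝ) (σ : ℝ → ℝ) : Prop where
  contDiff : ContDiff ℝ 2 σ
  abs_le : ∀ x, |σ x| ≤ M
  abs_deriv_le : ∀ x, |deriv σ x| ≤ M
  abs_deriv_deriv_le : ∀ x, |deriv (deriv σ) x| ≤ M

theorem IsSmoothBounded.abs_pairDual_sub_le {σ : ℝ → ℝ} {M η : ℝ} (h : IsSmoothBounded M σ)
    {s t c s' t' c' : ℝ} (h1 : IsCovTriple s t c) (h2 : IsCovTriple s' t' c')
    (hs : |s - s'| ≤ η) (ht : |t - t'| ≤ η) (hc : |c - c'| ≤ η) :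
    |pairDual σ s t c - pairDual σ s' t' c'| ≤ 2 * M ^ 2 * η :=
  _root_.abs_pairDual_sub_le h.contDiff h.abs_le h.abs_deriv_le h.abs_deriv_deriv_le
    h1.1 h1.2.1 h1.2.2 h2.1 h2.2.1 h2.2.2 hs ht hc

/-- Squeezed by the Lipschitz bound. It serves to make the deviation event at a node measurable, as
Fubini requires. -/
theorem IsSmoothBounded.continuous_pairDual {X : Type*} [TopologicalSpace X] {σ : ℝ → ℝ} {M : ℝ}
    (h : IsSmoothBounded M σ) {s t c : X → ℝ} (hs : Continuous s) (ht : Continuous t)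
    (hc : Continuous c) (hcov : ∀ x, IsCovTriple (s x) (t x) (c x)) :
    Continuous fun x => pairDual σ (s x) (t x) (c x) := by
  refine continuous_iff_continuousAt.2 fun x₀ => ?_
  rw [ContinuousAt, tendsto_iff_norm_sub_tendsto_zero]
  have hlim : Filter.Tendsto
      (fun x => 2 * M ^ 2 * (|s x - s x₀| + |t x - t x₀| + |c x - c x₀|)) (nhds x₀) (nhds 0) := by
    have : Continuous fun x => 2 * M ^ 2 * (|s x - s x₀| + |t x - t x₀| + |c x - c x₀|) := by
      fun_prop
    simpa using this.tendsto x₀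
  refine squeeze_zero (fun _ => norm_nonneg _) (fun x => ?_) hlim
  have h1 := abs_nonneg (s x - s x₀)
  have h2 := abs_nonneg (t x - t x₀)
  have h3 := abs_nonneg (c x - c x₀)
  exact h.abs_pairDual_sub_le (hcov x) (hcov x₀) (by linarith) (by linarith) (by linarith)

theorem IsCBounded.isSmoothBounded_normalizeAct {C : ℝ} {σ : ℝ → ℝ} (h : IsCBounded C σ)
    (hne : gaussNorm σ ≠ 0) : IsSmoothBounded C (normalizeAct σ) := by
  obtain ⟨h0, h1, h2, h3⟩ := h
  have hpos : 0 < gaussNorm σ := lt_of_le_of_ne (Real.sqrt_nonneg _) hne.symm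
  have hd : deriv (normalizeAct σ) = fun x => deriv σ x / gaussNorm σ := by
    ext x
    exact deriv_div_const _
  have hdd : deriv (deriv (normalizeAct σ)) = fun x => deriv (deriv σ) x / gaussNorm σ := by
    rw [hd]
    ext x
    exact deriv_div_const _
  have hb : ∀ {y : ℝ}, |y| ≤ gaussNorm σ * C → |y / gaussNorm σ| ≤ C := fun hy => by
    rw [abs_div, abs_of_pos hpos, div_le_iff₀ hpos, mul_comm]
    exact hy
  exact ⟨h0.div_const _, fun x => hb (h1 x), fun x => by rw [hd]; exact hb (h2 x),
    fun x => by rw [hdd]; exact hb (h3 x)⟩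

theorem integral_sq_normalizeAct {σ : ℝ → ℝ} (hne : gaussNorm σ ≠ 0) :
    ∫ x, normalizeAct σ x ^ 2 ∂(gaussianReal 0 1) = 1 := by
  have hsq : gaussNorm σ ^ 2 = ∫ x, σ x ^ 2 ∂(gaussianReal 0 1) :=
    Real.sq_sqrt (integral_nonneg fun x => sq_nonneg _)
  simp only [normalizeAct, div_pow, integral_div]
  rw [← hsq, div_self (pow_ne_zero 2 hne)]

/-- A unit second moment cannot exceed `C ^ 2`. This is what makes the Lipschitz factor `2 * C ^ 2`
at least 2 in the error recursion. -/
theorem one_le_of_isSmoothBounded {σ : ℝ → ℝ} {C : ℝ} (h : IsSmoothBounded C σ)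
    (h1 : ∫ x, σ x ^ 2 ∂(gaussianReal 0 1) = 1) : 1 ≤ C := by
  have h0 : 0 ≤ C := (abs_nonneg _).trans (h.abs_le 0)
  have := abs_integral_mul_le (gaussianReal 0 1) h.abs_le h.abs_le
  simp only [← sq, h1, abs_one] at this
  nlinarith

/-- The variables of a Gaussian pair with unit variances are standard Gaussian. -/
theorem pairDual_one_one_one {σ : ℝ → ℝ} (hσ : Continuous σ) :
    pairDual σ 1 1 1 = ∫ x, σ x ^ 2 ∂(gaussianReal 0 1) := by
  have h := pairDual_eq_integral_stdGaussianPi hσ (m := 1) (fun _ => 1) (fun _ => 1)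
  simp only [Finset.univ_unique, Finset.sum_singleton, one_mul] at h
  rw [← h]
  have := integral_comp_eval (μ := fun _ : Fin 1 => gaussianReal 0 1) (i := default)
    (f := fun x => σ x * σ x) (Continuous.aestronglyMeasurable (by fun_prop))
  simp only [sq]
  exact this

theorem abs_dualAct_le_one {σ : ℝ → ℝ} {M : ℝ} (h : IsSmoothBounded M σ)
    (h1 : ∫ x, σ x ^ 2 ∂(gaussianReal 0 1) = 1) {ρ : ℝ} (hρ : |ρ| ≤ 1) :
    |dualAct σ ρ| ≤ 1 := by
  have hσ := h.contDiff.continuous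
  have hρ2 : ρ ^ 2 ≤ 1 * 1 := by
    rw [one_mul, sq_le_one_iff_abs_le_one]; exact hρ
  obtain ⟨p, q, hp, hq, hpq⟩ := exists_fin_two_gram zero_le_one hρ2 zero_le_one
  have hI : ∀ a b : Fin 2 → ℝ, Integrable
      (fun w => σ (∑ i, a i * w i) * σ (∑ i, b i * w i)) (stdGaussianPi 2) := fun a b =>
    Integrable.of_bound (C := M * M) (Continuous.aestronglyMeasurable (by fun_prop))
      (Filter.Eventually.of_forall fun w => by
        rw [Real.norm_eq_abs, abs_mul]
        exact mul_le_mul (h.abs_le _) (h.abs_le _) (abs_nonneg _)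
          ((abs_nonneg _).trans (h.abs_le 0)))
  have e1 := pairDual_eq_integral_stdGaussianPi hσ p p
  have e2 := pairDual_eq_integral_stdGaussianPi hσ q q
  have e3 := pairDual_eq_integral_stdGaussianPi hσ p q
  rw [Fin.sum_univ_two (fun i => p i * p i), hp, pairDual_one_one_one hσ, h1] at e1
  rw [Fin.sum_univ_two (fun i => q i * q i), hq, pairDual_one_one_one hσ, h1] at e2
  rw [Fin.sum_univ_two (fun i => p i * p i), Fin.sum_univ_two (fun i => q i * q i),
    Fin.sum_univ_two (fun i => p i * q i), hp, hq, hpq] at e3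
  rw [dualAct_eq_pairDual, ← e3]
  -- The product is dominated by the mean of the two squares, and both marginals have second moment
  -- 1.
  have hmean : ∫ w, (σ (∑ i, p i * w i) * σ (∑ i, p i * w i)
      + σ (∑ i, q i * w i) * σ (∑ i, q i * w i)) / 2 ∂(stdGaussianPi 2) = 1 := by
    rw [integral_div, integral_add (hI p p) (hI q q), e1, e2]
    norm_num
  refine (norm_integral_le_of_norm_le (f := fun w => σ (∑ i, p i * w i) * σ (∑ i, q i * w i))
    (((hI p p).add (hI q q)).div_const 2) (Filter.Eventually.of_forall fun w => ?_)).trans_eq hmean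
  rw [Real.norm_eq_abs, abs_le]
  simp only [Pi.add_apply]
  constructor
  · nlinarith [sq_nonneg (σ (∑ i, p i * w i) + σ (∑ i, q i * w i))]
  · nlinarith [sq_nonneg (σ (∑ i, p i * w i) - σ (∑ i, q i * w i))]

/-! ### Neurons of the realization and empirical node kernels -/

namespace Skeleton

variable {n d r : ℕ} {V : Type*} [Fintype V] (S : Skeleton n V)

/-- The output of a neuron of the `r`-fold realization. -/
def neuron (d r : ℕ) (w : (S.realization d r).Edge → ℝ) (x : InputSpace n d) :
    (Fin n × Fin d) ⊕ (V × Fin r) → ℝ :=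
  (S.realization d r).eval w x

theorem neuron_inl (w : (S.realization d r).Edge → ℝ) (x : InputSpace n d) (p : Fin n × Fin d) :
    S.neuron d r w x (Sum.inl p) = (x p.1 : EuclideanSpace ℝ (Fin d)) p.2 := rfl

/-- The edge from `u` to `v`. -/
def edgeTo (v : V × Fin r) (u : {u // (S.realization d r).Adj u v}) : (S.realization d r).Edge :=
  ⟨(u.1, v), u.2⟩

theorem neuron_inr (w : (S.realization d r).Edge → ℝ) (x : InputSpace n d) (v : V × Fin r) :
    S.neuron d r w x (Sum.inr v) = S.act v.1
      (∑ u : {u // (S.realization d r).Adj u v}, w (S.edgeTo v u) * S.neuron d r w x u.1) := by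
  unfold neuron NeuralNetwork.eval
  rw [Dag.propagate_inr]
  rfl

theorem continuous_neuron (hS : ∀ v, Continuous (S.act v)) (x : InputSpace n d)
    (u : (Fin n × Fin d) ⊕ (V × Fin r)) : Continuous fun w => S.neuron d r w x u := by
  rcases u with p | v
  · exact continuous_const
  induction v using (S.realization d r).wellFounded.induction with
  | _ v ih =>
    simp only [neuron_inr]
    refine (hS _).comp (continuous_finsetSum _ fun u _ => ?_)
    refine (continuous_apply _).mul ?_
    obtain ⟨u | u, hu⟩ := u
    · exact continuous_const
    · exact ih u hu

/-- The output of a neuron does not depend on the weights into the copies of a node `v` from which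
it cannot be reached. -/
theorem neuron_congr (v : V) {w w' : (S.realization d r).Edge → ℝ}
    (hw : ∀ e : (S.realization d r).Edge, e.1.2.1 ≠ v → w e = w' e) (x : InputSpace n d)
    (j : Fin r) (u : (Fin n × Fin d) ⊕ (V × Fin r)) (hu : (S.realization d r).Adj u (v, j)) :
    S.neuron d r w x u = S.neuron d r w' x u := by
  have key : ∀ a : V × Fin r,
      ¬ Relation.ReflTransGen (fun u v : V => S.Adj (Sum.inr u) v) v a.1 →
      S.neuron d r w x (Sum.inr a) = S.neuron d r w' x (Sum.inr a) := by
    intro a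
    induction a using (S.realization d r).wellFounded.induction with
    | _ a ih =>
      intro ha
      rw [neuron_inr, neuron_inr]
      congr 1
      refine Finset.sum_congr rfl fun u _ => ?_
      have hav : a.1 ≠ v := fun h => ha (by rw [h])
      rw [hw (S.edgeTo a u) hav]
      congr 1
      obtain ⟨u | u, hu⟩ := u
      · rfl
      · exact ih u hu fun h => ha (h.tail hu)
  rcases u with p | u
  · rfl
  -- A path from `v` to `u` followed by the edge from `u` to `v` would close a cycle.
  · exact key u fun h => S.acyclic v (Relation.TransGen.tail' h hu)

/-- The empirical kernels of the nodes of a skeleton. -/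
def empNode (d r : ℕ) (w : (S.realization d r).Edge → ℝ) (x y : InputSpace n d) : Fin n ⊕ V → ℝ :=
  Sum.elim (fun i => inner ℝ (x i : EuclideanSpace ℝ (Fin d)) (y i : EuclideanSpace ℝ (Fin d)))
    fun v => (∑ j : Fin r, (S.neuron d r w x (Sum.inr (v, j)) / gaussNorm (S.act v)) *
      (S.neuron d r w y (Sum.inr (v, j)) / gaussNorm (S.act v))) / r

theorem empNode_inr (w : (S.realization d r).Edge → ℝ) (x y : InputSpace n d) (v : V) :
    S.empNode d r w x y (Sum.inr v) =
      (∑ j : Fin r, (S.neuron d r w x (Sum.inr (v, j)) / gaussNorm (S.act v)) *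
        (S.neuron d r w y (Sum.inr (v, j)) / gaussNorm (S.act v))) / r := rfl

/-- The mean of a function over `IN(v)`. -/
def inMean (κ : Fin n ⊕ V → ℝ) (v : V) : ℝ :=
  (∑ u : {u // S.Adj u v}, κ u) / ((S.inNbrs v).card : ℝ)

theorem nodeKernel_inr (x y : InputSpace n d) (v : V) :
    S.nodeKernel x y (Sum.inr v) =
      dualAct (normalizeAct (S.act v)) (S.inMean (S.nodeKernel x y) v) :=
  S.propagate_inr _ _ v

theorem mem_inNbrs {u : Fin n ⊕ V} {v : V} : u ∈ S.inNbrs v ↔ S.Adj u v := by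
  simp [Dag.inNbrs]

theorem card_inNbrs_pos (v : V) : 0 < (S.inNbrs v).card := by
  obtain ⟨u, hu⟩ := S.exists_adj v
  exact Finset.card_pos.2 ⟨u, S.mem_inNbrs.2 hu⟩

theorem sum_adj_eq_sum_inNbrs (v : V) (κ : Fin n ⊕ V → ℝ) :
    ∑ u : {u // S.Adj u v}, κ u = ∑ u ∈ S.inNbrs v, κ u :=
  (Finset.sum_subtype _ (fun _ => S.mem_inNbrs) κ).symm

/-- The sum over all the copies of a node. -/
def copySum (G : (Fin n × Fin d) ⊕ (V × Fin r) → ℝ) : Fin n ⊕ V → ℝ :=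
  Sum.elim (fun i => ∑ k, G (Sum.inl (i, k))) fun v => ∑ k, G (Sum.inr (v, k))

theorem sum_realization_adj (v : V × Fin r) (G : (Fin n × Fin d) ⊕ (V × Fin r) → ℝ) :
    ∑ u : {u // (S.realization d r).Adj u v}, G u = ∑ u ∈ S.inNbrs v.1, copySum G u := by
  classical
  rw [← Finset.sum_subtype (Finset.univ.filter fun u => (S.realization d r).Adj u v)
    (by simp) G]
  have h : S.inNbrs v.1 = Finset.univ.filter fun u => S.Adj u v.1 := by
    ext u
    simp [mem_inNbrs]
  rw [h, Finset.sum_filter, Finset.sum_filter, Fintype.sum_sum_type, Fintype.sum_sum_type,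
    Fintype.sum_prod_type, Fintype.sum_prod_type]
  congr 1
  · refine Finset.sum_congr rfl fun i _ => ?_
    by_cases hi : S.Adj (Sum.inl i) v.1
    · rw [if_pos hi]
      exact Finset.sum_congr rfl fun k _ => if_pos hi
    · rw [if_neg hi]
      exact Finset.sum_eq_zero fun k _ => if_neg hi
  · refine Finset.sum_congr rfl fun i _ => ?_
    by_cases hi : S.Adj (Sum.inr i) v.1
    · rw [if_pos hi]
      exact Finset.sum_congr rfl fun k _ => if_pos hi
    · rw [if_neg hi]
      exact Finset.sum_eq_zero fun k _ => if_neg hi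

theorem inWt_realization (hd : 0 < d) (v : V × Fin r) :
    (S.realization d r).inWt v = (S.inNbrs v.1).card := by
  have hr : 0 < r := v.2.pos
  have h1 : (S.realization d r).inWt v
      = ∑ u : {u // (S.realization d r).Adj u v}, ((S.realization d r).vwt u : ℝ) :=
    Finset.sum_subtype _ (by simp [Dag.inNbrs]) _
  rw [h1, sum_realization_adj S v fun u => ((S.realization d r).vwt u : ℝ)]
  rw [Finset.card_eq_sum_ones, Nat.cast_sum]
  refine Finset.sum_congr rfl fun u _ => ?_
  have hd' : (d : ℝ) ≠ 0 := by exact_mod_cast hd.ne'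
  have hr' : (r : ℝ) ≠ 0 := by exact_mod_cast hr.ne'
  rcases u with i | u
  · simp [copySum, realization, hd']
  · simp [copySum, realization, hr']

theorem edgeVar_nonneg (e : (S.realization d r).Edge) : 0 ≤ (S.realization d r).edgeVar e := by
  have h : ∀ v, 0 ≤ (S.realization d r).inWt v := fun v =>
    Finset.sum_nonneg fun u _ => NNReal.coe_nonneg _
  unfold NeuralNetwork.edgeVar
  split
  · exact div_nonneg (mul_nonneg (Nat.cast_nonneg _) (NNReal.coe_nonneg _)) (h _)
  · exact div_nonneg (NNReal.coe_nonneg _) (mul_nonneg (sq_nonneg _) (h _))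

/-- The covariance, given the weights below, of the inputs of a copy of the node `v`. -/
theorem sum_edgeVar_mul (hd : 0 < d) (w : (S.realization d r).Edge → ℝ) (x y : InputSpace n d)
    (v : V × Fin r) :
    ∑ u : {u // (S.realization d r).Adj u v}, (S.realization d r).edgeVar (S.edgeTo v u) *
      (S.neuron d r w x u * S.neuron d r w y u) = S.inMean (S.empNode d r w x y) v.1 := by
  have hd' : (d : ℝ) ≠ 0 := by exact_mod_cast hd.ne'
  -- The edge variances simplify to `1 / |IN(v)|` from an input neuron and `1 / (r * ‖σ_u‖ ^ 2 *
  -- |IN(v)|)` otherwise; the latter supplies the normalization and averaging in `empNode`.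
  set G : (Fin n × Fin d) ⊕ (V × Fin r) → ℝ := fun u =>
    (Sum.elim (fun _ => 1) (fun a => 1 / (r * gaussNorm (S.act a.1) ^ 2)) u) *
      (S.neuron d r w x u * S.neuron d r w y u) / (S.inNbrs v.1).card with hG
  have h1 : ∑ u : {u // (S.realization d r).Adj u v},
      (S.realization d r).edgeVar (S.edgeTo v u) * (S.neuron d r w x u * S.neuron d r w y u)
      = ∑ u : {u // (S.realization d r).Adj u v}, G u := by
    refine Finset.sum_congr rfl fun u _ => ?_
    obtain ⟨u | u, hu⟩ := u
    · simp only [hG, NeuralNetwork.edgeVar, edgeTo, inWt_realization S hd]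
      simp [realization, hd']
      ring
    · simp only [hG, NeuralNetwork.edgeVar, edgeTo, inWt_realization S hd]
      simp [realization]
      ring
  rw [h1, sum_realization_adj, inMean, sum_adj_eq_sum_inNbrs, Finset.sum_div]
  refine Finset.sum_congr rfl fun u _ => ?_
  rcases u with i | u
  · simp only [copySum, hG, empNode, Sum.elim_inl, one_mul, ← Finset.sum_div]
    congr 1
    rw [PiLp.inner_apply]
    refine Finset.sum_congr rfl fun k _ => ?_
    simp [neuron_inl, mul_comm]
  · simp only [copySum, hG, empNode, Sum.elim_inr, ← Finset.sum_div]
    congr 1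
    rw [Finset.sum_div]
    refine Finset.sum_congr rfl fun k _ => ?_
    rw [div_mul_div_comm, div_div, one_div, inv_mul_eq_div]
    congr 1
    ring

/-- These are weighted Gram entries of the inputs to any one copy of `v`; copy 0 exists because `r >
0`. -/
theorem isCovTriple_inMean (hd : 0 < d) (hr : 0 < r) (w : (S.realization d r).Edge → ℝ)
    (x y : InputSpace n d) (v : V) :
    IsCovTriple (S.inMean (S.empNode d r w x x) v) (S.inMean (S.empNode d r w y y) v)
      (S.inMean (S.empNode d r w x y) v) := by
  have h := isCovTriple_sum
    (v := fun u : {u // (S.realization d r).Adj u (v, (⟨0, hr⟩ : Fin r))} =>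
      (S.realization d r).edgeVar (S.edgeTo (v, ⟨0, hr⟩) u)) (fun u => S.edgeVar_nonneg _)
    (fun u => S.neuron d r w x u) (fun u => S.neuron d r w y u)
  rwa [sum_edgeVar_mul S hd, sum_edgeVar_mul S hd, sum_edgeVar_mul S hd] at h

theorem continuous_empNode (hS : ∀ v, Continuous (S.act v)) (x y : InputSpace n d)
    (u : Fin n ⊕ V) : Continuous fun w => S.empNode d r w x y u := by
  rcases u with i | v
  · exact continuous_const
  · refine (continuous_finsetSum _ fun j _ => ?_).div_const _
    exact ((S.continuous_neuron hS x _).div_const _).mul ((S.continuous_neuron hS y _).div_const _)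

theorem continuous_inMean (hS : ∀ v, Continuous (S.act v)) (x y : InputSpace n d) (v : V) :
    Continuous fun w => S.inMean (S.empNode d r w x y) v := by
  unfold inMean
  exact (continuous_finsetSum _ fun (u : {u // S.Adj u v}) _ =>
    S.continuous_empNode hS x y u.1).div_const _

/-! ### Conditional concentration at a single node -/

/-- The error made at the node `v` alone by the empirical kernels. -/
def layerError (w : (S.realization d r).Edge → ℝ) (x y : InputSpace n d) (v : V) : ℝ :=
  |S.empNode d r w x y (Sum.inr v) - pairDual (normalizeAct (S.act v))
    (S.inMean (S.empNode d r w x x) v) (S.inMean (S.empNode d r w y y) v)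
    (S.inMean (S.empNode d r w x y) v)|

open Classical in
theorem sum_fiber_eq_sum_adj (v : V) (j : Fin r) (F : (S.realization d r).Edge → ℝ) :
    ∑ e : {e : {e : (S.realization d r).Edge // e.1.2.1 = v} // e.1.1.2.2 = j}, F e.1.1
      = ∑ u : {u // (S.realization d r).Adj u (v, j)}, F (S.edgeTo (v, j) u) := by
  symm
  refine Fintype.sum_bijective (fun u => ⟨⟨S.edgeTo (v, j) u, rfl⟩, rfl⟩) ⟨?_, ?_⟩ _ _
    fun u => rfl
  · intro a b hab
    exact Subtype.ext (congrArg (fun e => e.1.1.1.1) hab)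
  · rintro ⟨⟨⟨⟨u, ⟨a, k⟩⟩, hu⟩, rfl⟩, rfl⟩
    exact ⟨⟨u, hu⟩, rfl⟩

theorem measureReal_layerError_le (hd : 0 < d) (hr : 0 < r) {C : ℝ}
    (hS : ∀ v, IsSmoothBounded C (normalizeAct (S.act v))) (hS' : ∀ v, Continuous (S.act v))
    (x y : InputSpace n d) (v : V) {η : ℝ} (hη : 0 ≤ η) :
    (S.realization d r).randomInit.real {w | η < S.layerError w x y v}
      ≤ 2 * Real.exp (-(r * η ^ 2 / (2 * (C ^ 2) ^ 2))) := by
  classical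
  set N := S.realization d r
  set μ : N.Edge → Measure ℝ := fun e => gaussianReal 0 (N.edgeVar e).toNNReal
  set P : N.Edge → Prop := fun e => e.1.2.1 = v
  have hcont : Continuous fun w => S.layerError (d := d) (r := r) w x y v := by
    refine ((S.continuous_empNode hS' x y _).sub ?_).abs
    exact (hS v).continuous_pairDual (S.continuous_inMean hS' x x v)
      (S.continuous_inMean hS' y y v) (S.continuous_inMean hS' x y v)
      fun w => S.isCovTriple_inMean hd hr w x y v
  have hmeas : MeasurableSet {w | η < S.layerError (d := d) (r := r) w x y v} :=
    (isOpen_lt continuous_const hcont).measurableSet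
  set Φ := MeasurableEquiv.piEquivPiSubtypeProd (fun _ : N.Edge => ℝ) P
  have hmp := (measurePreserving_piEquivPiSubtypeProd μ P).symm
  have hB : 0 ≤ 2 * Real.exp (-(r * η ^ 2 / (2 * (C ^ 2) ^ 2))) := by positivity
  rw [measureReal_def, NeuralNetwork.randomInit,
    ← hmp.measure_preimage hmeas.nullMeasurableSet]
  refine ENNReal.toReal_le_of_le_ofReal hB ?_
  rw [Measure.prod_apply_symm (Φ.symm.measurable hmeas)]
  refine (lintegral_mono (g := fun _ => ENNReal.ofReal
    (2 * Real.exp (-(r * η ^ 2 / (2 * (C ^ 2) ^ 2))))) fun w' => ?_).trans (by simp)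
  -- The zero is an arbitrary filler: everything feeding the copies of `v` is determined by `w'`.
  set w₀ : N.Edge → ℝ := Φ.symm (0, w') with hw₀
  have hpos : ∀ (a : {e // P e} → ℝ) (e : N.Edge) (he : P e), Φ.symm (a, w') e = a ⟨e, he⟩ :=
    fun a e he => dif_pos he
  have hneg : ∀ (a : {e // P e} → ℝ) (e : N.Edge), ¬ P e → Φ.symm (a, w') e = w₀ e :=
    fun a e he => by
      have h : ∀ a : {e // P e} → ℝ, Φ.symm (a, w') e = w' ⟨e, he⟩ := fun a => dif_neg he
      rw [hw₀, h, h]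
  have hnb : ∀ (a : {e // P e} → ℝ) (z : InputSpace n d) (j : Fin r) u, N.Adj u (v, j) →
      S.neuron d r (Φ.symm (a, w')) z u = S.neuron d r w₀ z u := fun a z j u hu =>
    S.neuron_congr v (fun e he => hneg a e he) z j u hu
  have hmean : ∀ (a : {e // P e} → ℝ) (z z' : InputSpace n d),
      S.inMean (S.empNode d r (Φ.symm (a, w')) z z') v
        = S.inMean (S.empNode d r w₀ z z') v := fun a z z' => by
    rw [← S.sum_edgeVar_mul hd _ z z' (v, (⟨0, hr⟩ : Fin r)),
      ← S.sum_edgeVar_mul hd _ z z' (v, (⟨0, hr⟩ : Fin r))]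
    refine Finset.sum_congr rfl fun u _ => ?_
    rw [hnb a z _ u u.2, hnb a z' _ u u.2]
  have hneu : ∀ (a : {e // P e} → ℝ) (z : InputSpace n d) (j : Fin r),
      S.neuron d r (Φ.symm (a, w')) z (Sum.inr (v, j)) / gaussNorm (S.act v)
        = normalizeAct (S.act v) (∑ e : {e : {e // P e} // e.1.1.2.2 = j},
          S.neuron d r w₀ z e.1.1.1.1 * a e.1) := fun a z j => by
    rw [neuron_inr, normalizeAct]
    refine congrArg (fun t => S.act v t / gaussNorm (S.act v)) ?_
    have h1 : ∑ e : {e : {e // P e} // e.1.1.2.2 = j}, S.neuron d r w₀ z e.1.1.1.1 * a e.1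
        = ∑ e : {e : {e // P e} // e.1.1.2.2 = j},
          S.neuron d r w₀ z e.1.1.1.1 * Φ.symm (a, w') e.1.1 :=
      Finset.sum_congr rfl fun e _ => by rw [hpos a e.1.1 e.1.2]
    rw [h1, S.sum_fiber_eq_sum_adj v j
      (fun e => S.neuron d r w₀ z e.1.1 * Φ.symm (a, w') e)]
    refine Finset.sum_congr rfl fun u _ => ?_
    rw [hnb a z j u u.2, mul_comm]
    rfl
  have hgram : ∀ (z z' : InputSpace n d) (j : Fin r),
      ∑ e : {e : {e // P e} // e.1.1.2.2 = j}, ((N.edgeVar e.1.1).toNNReal : ℝ) *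
        (S.neuron d r w₀ z e.1.1.1.1 * S.neuron d r w₀ z' e.1.1.1.1)
        = S.inMean (S.empNode d r w₀ z z') v := fun z z' j => by
    rw [S.sum_fiber_eq_sum_adj v j (fun e => ((N.edgeVar e).toNNReal : ℝ) *
        (S.neuron d r w₀ z e.1.1 * S.neuron d r w₀ z' e.1.1)),
      ← S.sum_edgeVar_mul hd _ z z' (v, j)]
    refine Finset.sum_congr rfl fun u _ => ?_
    rw [Real.coe_toNNReal _ (S.edgeVar_nonneg _)]
    rfl
  have main := measureReal_layer_le hr (fun e : {e // P e} => e.1.1.2.2)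
    (fun e => (N.edgeVar e.1).toNNReal) (fun e => S.neuron d r w₀ x e.1.1.1)
    (fun e => S.neuron d r w₀ y e.1.1.1) (hS v).contDiff.continuous (hS v).abs_le
    (fun j => by simp only [sq]; exact hgram x x j)
    (fun j => by simp only [sq]; exact hgram y y j) (fun j => hgram x y j) hη
  rw [measureReal_def, ← ENNReal.le_ofReal_iff_toReal_le (measure_ne_top _ _) hB] at main
  refine le_trans (measure_mono fun a ha => ?_) main
  have hle : S.layerError (d := d) (r := r) (Φ.symm (a, w')) x y v
      = |(∑ j, normalizeAct (S.act v) (∑ e : {e : {e // P e} // e.1.1.2.2 = j},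
          S.neuron d r w₀ x e.1.1.1.1 * a e.1) *
        normalizeAct (S.act v) (∑ e : {e : {e // P e} // e.1.1.2.2 = j},
          S.neuron d r w₀ y e.1.1.1.1 * a e.1)) / r -
        pairDual (normalizeAct (S.act v)) (S.inMean (S.empNode d r w₀ x x) v)
          (S.inMean (S.empNode d r w₀ y y) v) (S.inMean (S.empNode d r w₀ x y) v)| := by
    rw [layerError, hmean a x x, hmean a y y, hmean a x y, empNode_inr]
    simp only [hneu]
  have ha' : η < S.layerError (d := d) (r := r) (Φ.symm (a, w')) x y v := ha
  rw [hle] at ha'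
  exact ha'

end Skeleton

/-! ### Error propagation through the skeleton -/

namespace Skeleton

variable {n d r : ℕ} {V : Type*} [Fintype V] (S : Skeleton n V)

theorem node_induction {P : Fin n ⊕ V → Prop} (hinl : ∀ i, P (Sum.inl i))
    (hinr : ∀ v, (∀ u, S.Adj u v → P u) → P (Sum.inr v)) (u : Fin n ⊕ V) : P u := by
  rcases u with i | v
  · exact hinl i
  induction v using S.wellFounded.induction with
  | _ v ih =>
    refine hinr v fun u hu => ?_
    rcases u with i | u
    · exact hinl i
    · exact ih u hu

theorem nodeDepth_succ_le {u : Fin n ⊕ V} {v : V} (h : S.Adj u v) :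
    S.nodeDepth u + 1 ≤ S.nodeDepth (Sum.inr v) := by
  have h1 : S.nodeDepth (Sum.inr v)
      = Finset.univ.sup (fun u : {u // S.Adj u v} => S.nodeDepth u) + 1 :=
    S.propagate_inr _ _ v
  rw [h1]
  exact Nat.succ_le_succ
    (Finset.le_sup (f := fun u : {u // S.Adj u v} => S.nodeDepth u) (Finset.mem_univ ⟨u, h⟩))

/-- Averaging does not amplify errors, so the final bound is independent of the in-degrees. -/
theorem abs_inMean_sub_le {κ κ' : Fin n ⊕ V → ℝ} {B : ℝ} {v : V}
    (h : ∀ u, S.Adj u v → |κ u - κ' u| ≤ B) : |S.inMean κ v - S.inMean κ' v| ≤ B := by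
  have hpos : (0 : ℝ) < (S.inNbrs v).card := by exact_mod_cast S.card_inNbrs_pos v
  rw [inMean, inMean, sum_adj_eq_sum_inNbrs, sum_adj_eq_sum_inNbrs, ← sub_div,
    ← Finset.sum_sub_distrib, abs_div, abs_of_pos hpos, div_le_iff₀ hpos, mul_comm,
    ← nsmul_eq_mul, ← Finset.sum_const]
  exact (Finset.abs_sum_le_sum_abs _ _).trans
    (Finset.sum_le_sum fun u hu => h u (S.mem_inNbrs.1 hu))

theorem inMean_eq_one {κ : Fin n ⊕ V → ℝ} {v : V} (h : ∀ u, S.Adj u v → κ u = 1) :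
    S.inMean κ v = 1 := by
  have hpos : ((S.inNbrs v).card : ℝ) ≠ 0 := by exact_mod_cast (S.card_inNbrs_pos v).ne'
  rw [inMean, sum_adj_eq_sum_inNbrs, Finset.sum_congr rfl fun u hu => h u (S.mem_inNbrs.1 hu)]
  simp [hpos]

theorem abs_inMean_le_one {κ : Fin n ⊕ V → ℝ} {v : V} (h : ∀ u, S.Adj u v → |κ u| ≤ 1) :
    |S.inMean κ v| ≤ 1 := by
  have := S.abs_inMean_sub_le (κ := κ) (κ' := 0) (v := v) (B := 1) (by simpa using h)
  simpa [inMean] using this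

/-- Unit inputs and normalized activations preserve the value 1. Thus the ideal covariance has unit
diagonal, where `pairDual` is `dualAct`. -/
theorem nodeKernel_self {C : ℝ} (hS : ∀ v, IsSmoothBounded C (normalizeAct (S.act v)))
    (hne : ∀ v, gaussNorm (S.act v) ≠ 0) (x : InputSpace n d) (u : Fin n ⊕ V) :
    S.nodeKernel x x u = 1 := by
  induction u using S.node_induction with
  | hinl i =>
    change inner ℝ (x i : EuclideanSpace ℝ (Fin d)) (x i : EuclideanSpace ℝ (Fin d)) = 1
    rw [real_inner_self_eq_norm_sq, norm_eq_of_mem_sphere, one_pow]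
  | hinr v ih =>
    rw [nodeKernel_inr, S.inMean_eq_one ih, dualAct_eq_pairDual,
      pairDual_one_one_one (hS v).contDiff.continuous, integral_sq_normalizeAct (hne v)]

theorem abs_nodeKernel_le_one {C : ℝ} (hS : ∀ v, IsSmoothBounded C (normalizeAct (S.act v)))
    (hne : ∀ v, gaussNorm (S.act v) ≠ 0) (x y : InputSpace n d) (u : Fin n ⊕ V) :
    |S.nodeKernel x y u| ≤ 1 := by
  induction u using S.node_induction with
  | hinl i =>
    have h := abs_real_inner_le_norm (x i : EuclideanSpace ℝ (Fin d))
      (y i : EuclideanSpace ℝ (Fin d))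
    rwa [norm_eq_of_mem_sphere, norm_eq_of_mem_sphere, one_mul] at h
  | hinr v ih =>
    rw [nodeKernel_inr]
    exact abs_dualAct_le_one (hS v) (integral_sq_normalizeAct (hne v)) (S.abs_inMean_le_one ih)

/-- If the error made at each node alone is at most `η`, then the accumulated errors are
bounded. -/
theorem abs_empNode_sub_nodeKernel_le (hd : 0 < d) (hr : 0 < r) {C η : ℝ} (hC : 1 ≤ C)
    (hη : 0 ≤ η) (hS : ∀ v, IsSmoothBounded C (normalizeAct (S.act v)))
    (hne : ∀ v, gaussNorm (S.act v) ≠ 0) (w : (S.realization d r).Edge → ℝ) {ι : Type*}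
    (z : ι → InputSpace n d) (hw : ∀ i j v, S.layerError w (z i) (z j) v ≤ η) (u : Fin n ⊕ V)
    (i j : ι) :
    |S.empNode d r w (z i) (z j) u - S.nodeKernel (z i) (z j) u|
      ≤ ((2 * C ^ 2) ^ S.nodeDepth u - 1) * η := by
  have hβ : 2 ≤ 2 * C ^ 2 := by nlinarith
  -- The step for the pair `(i, j)` also uses the bounds for `(i, i)` and `(j, j)`, which control
  -- the variances.
  induction u using S.node_induction generalizing i j with
  | hinl a =>
    have h1 : S.nodeDepth (Sum.inl a) = 0 := rfl
    have h2 : S.empNode d r w (z i) (z j) (Sum.inl a) = S.nodeKernel (z i) (z j) (Sum.inl a) := rfl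
    simp [h1, h2]
  | hinr v ih =>
    obtain ⟨k, hk⟩ : ∃ k, S.nodeDepth (Sum.inr v) = k + 1 := by
      obtain ⟨u, hu⟩ := S.exists_adj v
      have := S.nodeDepth_succ_le hu
      exact ⟨S.nodeDepth (Sum.inr v) - 1, by omega⟩
    have hmean : ∀ i j, |S.inMean (S.empNode d r w (z i) (z j)) v
        - S.inMean (S.nodeKernel (z i) (z j)) v| ≤ ((2 * C ^ 2) ^ k - 1) * η := fun i j =>
      S.abs_inMean_sub_le fun u hu => (ih u hu i j).trans <| by
        have := S.nodeDepth_succ_le hu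
        have : (2 * C ^ 2) ^ S.nodeDepth u ≤ (2 * C ^ 2) ^ k :=
          pow_le_pow_right₀ (by linarith) (by omega)
        gcongr
    have hself : ∀ i, S.inMean (S.nodeKernel (z i) (z i)) v = 1 := fun i =>
      S.inMean_eq_one fun u _ => S.nodeKernel_self hS hne (z i) u
    have h1 := hmean i i
    have h2 := hmean j j
    rw [hself] at h1 h2
    have hρ : IsCovTriple 1 1 (S.inMean (S.nodeKernel (z i) (z j)) v) :=
      ⟨zero_le_one, zero_le_one, by
        rw [one_mul, sq_le_one_iff_abs_le_one]
        exact S.abs_inMean_le_one fun u _ => S.abs_nodeKernel_le_one hS hne _ _ u⟩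
    have hlip := (hS v).abs_pairDual_sub_le (S.isCovTriple_inMean hd hr w (z i) (z j) v) hρ
      h1 h2 (hmean i j)
    have hlayer := hw i j v
    rw [layerError] at hlayer
    rw [nodeKernel_inr, dualAct_eq_pairDual, hk]
    refine (abs_sub_le _ _ _).trans ((add_le_add hlayer hlip).trans ?_)
    -- The recursion closes with slack `(2 * C ^ 2 - 2) * η`, nonnegative because `C ≥ 1`.
    have : ((2 * C ^ 2) ^ (k + 1) - 1) * η - (η + 2 * C ^ 2 * (((2 * C ^ 2) ^ k - 1) * η))
        = (2 * C ^ 2 - 2) * η := by ring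
    have := mul_nonneg (sub_nonneg.2 hβ) hη
    linarith

theorem empKernel_realization (hr : 0 < r) (w : (S.realization d r).Edge → ℝ)
    (x y : InputSpace n d) :
    (S.realization d r).empKernel w x y = S.empNode d r w x y (Sum.inr S.out) := by
  have hmem : ∀ v : V × Fin r, v ∈ (S.realization d r).outputs ↔ v.1 = S.out := fun v => by
    rw [← S.out_iff]
    simp only [NeuralNetwork.outputs, Finset.mem_filter, Finset.mem_univ, true_and]
    exact ⟨fun h u => h (u, ⟨0, hr⟩), fun h u => h u.1⟩
  have hout : (S.realization d r).outputs
      = Finset.univ.map ⟨fun j : Fin r => (S.out, j), fun a b h => (Prod.mk.inj h).2⟩ := by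
    ext v
    rw [hmem]
    simp only [Finset.mem_map, Finset.mem_univ, true_and]
    constructor
    · intro h
      exact ⟨v.2, Prod.ext h.symm rfl⟩
    · rintro ⟨j, rfl⟩
      rfl
  have hcard : (S.realization d r).outputs.card = r := by
    rw [hout, Finset.card_map, Finset.card_univ, Fintype.card_fin]
  rw [NeuralNetwork.empKernel, PiLp.inner_apply, empNode_inr, Finset.sum_div]
  simp only [NeuralNetwork.normRep, hcard]
  rw [Finset.sum_coe_sort (S.realization d r).outputs fun v => inner ℝ
    ((S.realization d r).eval w x (Sum.inr v) / (gaussNorm ((S.realization d r).act v) * √(r : ℝ)))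
    ((S.realization d r).eval w y (Sum.inr v) / (gaussNorm ((S.realization d r).act v) * √(r : ℝ))),
    hout, Finset.sum_map]
  refine Finset.sum_congr rfl fun j _ => ?_
  -- The real inner product unfolds with its factors in swapped order.
  change (S.neuron d r w y (Sum.inr (S.out, j)) / (gaussNorm (S.act S.out) * √(r : ℝ))) *
    (S.neuron d r w x (Sum.inr (S.out, j)) / (gaussNorm (S.act S.out) * √(r : ℝ))) = _
  have hs : √(r : ℝ) * √(r : ℝ) = r := Real.mul_self_sqrt (Nat.cast_nonneg r)
  rw [div_mul_div_comm, div_mul_div_comm, div_div, mul_mul_mul_comm, hs, mul_comm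
    (S.neuron d r w y _)]

/-- There is an input node: follow edges backwards from any node. -/
theorem exists_input (S : Skeleton n V) (v : V) : Nonempty (Fin n) := by
  induction v using S.wellFounded.induction with
  | _ v ih =>
    obtain ⟨u | u, hu⟩ := S.exists_adj v
    · exact ⟨u⟩
    · exact ih u hu

theorem pos_of_inputSpace (S : Skeleton n V) (x : InputSpace n d) : 0 < d := by
  obtain ⟨i⟩ := S.exists_input S.out
  rcases Nat.eq_zero_or_pos d with rfl | h
  · have h1 := norm_eq_of_mem_sphere (x i)
    rw [Subsingleton.elim (x i : EuclideanSpace ℝ (Fin 0)) 0, norm_zero] at h1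
    norm_num at h1
  · exact h

end Skeleton

end

theorem theorem1 {n d : ℕ} {V : Type*} [Fintype V] (S : Skeleton n V) (C : ℝ)
    (hC : ∀ v, IsCBounded C (S.act v)) (hne : ∀ v, gaussNorm (S.act v) ≠ 0)
    (ε δ : ℝ) (hε : 0 < ε) (hδ : 0 < δ) (r : ℕ)
    (hr : (4 * C ^ 4) ^ (S.depth + 1) * Real.log (8 * (Fintype.card V : ℝ) / δ) / ε ^ 2 ≤ (r : ℝ))
    (x x' : InputSpace n d) :
    1 - δ ≤ (S.realization d r).randomInit.real
      {w | |(S.realization d r).empKernel w x x' - S.kernel x x'| ≤ ε} := by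
  have hprob : IsProbabilityMeasure (S.realization d r).randomInit := by
    unfold NeuralNetwork.randomInit
    infer_instance
  -- The case `δ ≥ 1` is vacuous; otherwise the logarithm is positive, which forces `r > 0`.
  rcases le_or_gt 1 δ with hδ1 | hδ1
  · exact (sub_nonpos.2 hδ1).trans measureReal_nonneg
  have hS : ∀ v, IsSmoothBounded C (normalizeAct (S.act v)) := fun v =>
    (hC v).isSmoothBounded_normalizeAct (hne v)
  have hS' : ∀ v, Continuous (S.act v) := fun v => (hC v).1.continuous
  have hC1 : 1 ≤ C := one_le_of_isSmoothBounded (hS S.out) (integral_sq_normalizeAct (hne S.out))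
  have hd := S.pos_of_inputSpace x
  have hV : (1 : ℝ) ≤ Fintype.card V := by
    have : 0 < Fintype.card V := Fintype.card_pos_iff.2 ⟨S.out⟩
    exact_mod_cast this
  have hK : 1 < 8 * (Fintype.card V : ℝ) / δ := by
    rw [one_lt_div hδ]
    linarith
  have hK0 : 0 < 8 * (Fintype.card V : ℝ) / δ := zero_lt_one.trans hK
  have hlog : 0 < Real.log (8 * (Fintype.card V : ℝ) / δ) := Real.log_pos hK
  have hC0 : 0 < C := zero_lt_one.trans_le hC1
  have hr0 : 0 < r := by
    have : (0 : ℝ) < r := lt_of_lt_of_le (by positivity) hr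
    exact_mod_cast this
  set D := S.depth
  -- Chosen so that amplification by `2 * C ^ 2` at each level ends at `ε`.
  set η : ℝ := ε / (2 * C ^ 2) ^ D with hη
  have hη0 : 0 < η := by positivity
  set z : Fin 2 → InputSpace n d := ![x, x']
  set bad : Set ((S.realization d r).Edge → ℝ) :=
    ⋃ a : V × Fin 2 × Fin 2, {w | η < S.layerError w (z a.2.1) (z a.2.2) a.1}
  have hexp : Real.exp (-(r * η ^ 2 / (2 * (C ^ 2) ^ 2))) ≤ δ / (8 * Fintype.card V) := by
    -- Squaring `η` costs `(4 * C ^ 4) ^ D`; the extra factor `4 * C ^ 4` in the hypothesis covers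
    -- Hoeffding's `2 * C ^ 4` with a factor 2 to spare.
    have h1 : Real.log (8 * (Fintype.card V : ℝ) / δ) ≤ r * η ^ 2 / (2 * (C ^ 2) ^ 2) := by
      rw [div_le_iff₀ (by positivity)] at hr
      have hpow : ((2 * C ^ 2) ^ D) ^ 2 = (4 * C ^ 4) ^ D := by
        rw [← pow_mul, mul_comm D 2, pow_mul]
        congr 1
        ring
      rw [hη, div_pow, hpow, ← mul_div_assoc, div_div, le_div_iff₀ (by positivity)]
      refine le_trans ?_ hr
      rw [pow_succ (4 * C ^ 4) D]
      have : 0 < (4 * C ^ 4) ^ D * Real.log (8 * (Fintype.card V : ℝ) / δ) * C ^ 4 := by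
        positivity
      nlinarith
    calc Real.exp (-(r * η ^ 2 / (2 * (C ^ 2) ^ 2)))
        ≤ Real.exp (-Real.log (8 * (Fintype.card V : ℝ) / δ)) :=
          Real.exp_le_exp.2 (neg_le_neg h1)
      _ = δ / (8 * Fintype.card V) := by rw [Real.exp_neg, Real.exp_log hK0, inv_div]
  have hbadμ : (S.realization d r).randomInit.real bad ≤ δ := by
    refine (measureReal_iUnion_fintype_le _).trans ?_
    calc ∑ a : V × Fin 2 × Fin 2, (S.realization d r).randomInit.real
          {w | η < S.layerError w (z a.2.1) (z a.2.2) a.1}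
        ≤ ∑ a : V × Fin 2 × Fin 2, 2 * (δ / (8 * Fintype.card V)) :=
          Finset.sum_le_sum fun a _ => (S.measureReal_layerError_le hd hr0 hS hS' _ _ _ hη0.le).trans
            (mul_le_mul_of_nonneg_left hexp zero_le_two)
      -- There are `4 * |V|` events, each of probability at most `2 * δ / (8 * |V|)`.
      _ = δ := by
          simp
          field_simp
          norm_num
  -- Covering the whole space and using subadditivity avoids complements, hence any measurability of
  -- the good event.
  have hsub : Set.univ ⊆ bad ∪
      {w | |(S.realization d r).empKernel w x x' - S.kernel x x'| ≤ ε} := by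
    intro w _
    by_cases hw : w ∈ bad
    · exact Or.inl hw
    refine Or.inr ?_
    have hw' : ∀ i j v, S.layerError w (z i) (z j) v ≤ η := fun i j v =>
      not_lt.1 fun h => hw (Set.mem_iUnion.2 ⟨(v, i, j), h⟩)
    have h := S.abs_empNode_sub_nodeKernel_le hd hr0 hC1 hη0.le hS hne w z hw'
      (Sum.inr S.out) 0 1
    rw [← S.empKernel_realization hr0] at h
    change |(S.realization d r).empKernel w x x' - S.kernel x x'| ≤ ε
    refine h.trans ?_
    have hdepth : S.nodeDepth (Sum.inr S.out) ≤ D := Finset.le_sup (Finset.mem_univ _)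
    have hβ : 1 ≤ 2 * C ^ 2 := by nlinarith
    calc ((2 * C ^ 2) ^ S.nodeDepth (Sum.inr S.out) - 1) * η ≤ (2 * C ^ 2) ^ D * η := by
          have := pow_le_pow_right₀ hβ hdepth
          gcongr
          linarith
      _ = ε := by rw [hη]; field_simp
  have := (measureReal_mono hsub).trans (measureReal_union_le
    (μ := (S.realization d r).randomInit) _ _)
  rw [probReal_univ] at this
  linarith
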